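/- **Setting.** Let $\|\cdot\|$ be the Euclidean norm and $\mathcal B_\rho(x)$ the closed ball. Let $\mathbb U\subset\mathbb R^m$ be convex and compact with $0\in\operatorname{int}\mathbb U$. Let $f:\mathbb R^n\times\mathbb U\to\mathbb R^n$ be continuous with $f(0,0)=0$, and Lipschitz in $x$ on every compact set, uniformly in $u\in\mathbb U$. Let $Q,R$ be symmetric positive definite, $\ell(x,u)=x^\top Qx+u^\top Ru$ and $\ell^\star(x)=\min_{u\in\mathbb U}\ell(x,u)=x^\top Qx$. A control sequence of length $N\in\mathbb N\cup\{\infty\}$ is admissible, $\mathbf u\in\mathcal U_N$, if all its entries lie in $\mathbb U$. Let $x_{\mathbf u}(k;\hat x)$ denote the trajectory of $x^+=f(x,u)$ from $\hat x$, $J_N(\hat x,\mathbf u)=\sum_{k=0}^{N-1}\ell(x_{\mathbf u}(k;\hat x),u(k))$ and $V_N(\hat x)=\inf_{\mathbf u\in\mathcal U_N}J_N(\hat x,\mathbf u)$. For surrogate models $f^\varepsilon:\mathbb R^n\times\mathbb U\to\mathbb R^n$, $\varepsilon\in(0,\bar\varepsilon]$, $\bar\varepsilon>0$, define $x^\varepsilon_{\mathbf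 u}$, $J_N^\varepsilon$, $V_N^\varepsilon$ in the same way with $f^\varepsilon$ in place of $f$. **Assumptions.** Let $S,\Omega\subseteq\mathbb R^n$ contain the origin in their interiors and let $N\ge 2$. 1. (Cost controllability on $S$.) There is a nondecreasing bounded sequence $(B_k)_{k\in\mathbb N_0}$ such that for every $\hat x\in S$ there is $\mathbf u\in\mathcal U_\infty$ with $x_{\mathbf u}(k;\hat x)\in S$ for all $k\ge 0$ and $V_k(\hat x)\le J_k(\hat x,\mathbf u)\le B_k\,\ell^\star(\hat x)$ for all $k\ge1$. 2. (Error bounds.) For all $\varepsilon\in(0,\bar\varepsilon]$, $x\in\Omega$, $u\in\mathbb U$ one has $\|f(x,u)-f^\varepsilon(x,u)\|\le c_x^\varepsilon\|x\|+c_u^\varepsilon\|u\|$ and $\|f(x,u)-f^\varepsilon(x,u)\|\le\eta^\varepsilon$, with $\eta^\varepsilon>0$ and $\lim_{\varepsilon\searrow0}\max\{c_x^\varepsilon,c_u^\varepsilon,\eta^\varepsilon\}=0$. 3. (Uniform Lipschitz continuity.) There is $\bar L\ge 0$ such that for every $\varepsilon\in(0,\bar\varepsilon]$ there is $L_{f^\varepsilon}\le\bar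 L$ with $\|f^\varepsilon(x,u)-f^\varepsilon(y,u)\|\le L_{f^\varepsilon}\|x-y\|$ for all $x,y\in\Omega$, $u\in\mathbb U$. 4. With $r(N):=\sum_{i=0}^{N-1}\bar L^i$, one has $S\oplus\mathcal B_{r(N)\eta^\varepsilon}(0)\subseteq\Omega$ for all $\varepsilon\in(0,\bar\varepsilon]$, where $\oplus$ is the Minkowski sum. 5. $\alpha_N\in(0,1]$, where $$\alpha_N:=1-\frac{(B_2-1)(B_N-1)\prod_{i=3}^N(B_i-1)}{\prod_{i=2}^NB_i-(B_2-1)\prod_{i=3}^N(B_i-1)}.$$ **Claim.** There is $\varepsilon_0\in(0,\bar\varepsilon]$ such that the following holds for all $\varepsilon\in(0,\varepsilon_0)$ and all $c>0$. Let $Y:=\{x\in\mathbb R^n: V_N^\varepsilon(x)\le c\}$ satisfy $Y\subseteq S$, and suppose that optimal predictions starting in $Y$ stay inside $\Omega$, in the sense that $\mathcal B_{r(N)\eta^\varepsilon}(x^\varepsilon_{\mathbf u^\star}(k;\hat x))\subseteq\Omega$ for all $\hat x\in Y$, all minimizers $\mathbf u^\star$ of $J_N^\varepsilon(\hat x,\cdot)$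 over $\mathcal U_N$, and all $k=0,\dots,N-2$. (For $N=2$ this follows from 4. For every $N$ it holds if the $r(N)\eta^\varepsilon$-neighbourhood of $\{x:x^\top Qx\le c\}$ is contained in $\Omega$.) Let $\mu:\mathbb R^n\to\mathbb R^m$ be any MPC feedback law on $Y$ for the surrogate, i.e. for every $\hat x\in Y$, $\mu(\hat x)$ is the first element of a minimizer of $J_N^\varepsilon(\hat x,\cdot)$ over $\mathcal U_N$. Then the origin is asymptotically stable on $Y$ for the true closed loop $x(k+1)=f(x(k),\mu(x(k)))$: $Y$ is a forward invariant neighbourhood of the origin, and there is a $\mathcal{KL}$ function $\beta$ with $\|x(k)\|\le\beta(\|x(0)\|,k)$ for all $x(0)\in Y$, $k\ge0$. Here $\beta:[0,\infty)\times\mathbb N_0\to[0,\infty)$ is of class $\mathcal{KL}$ if each $\beta(\cdot,k)$ is continuous, strictly increasing and zero at $0$, and each $\beta(r,\cdot)$ is nonincreasing with limit $0$. -/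

import Mathlib

open Set Filter Topology
open scoped Pointwise

noncomputable section

namespace SurrogateMPC

/-- State and input spaces: `ℝ^d` with the Euclidean norm. -/
abbrev E (d : ℕ) : Type := EuclideanSpace ℝ (Fin d)

/-- The quadratic form `‖x‖_M² = xᵀ M x`. -/
def weightedSq {d : ℕ} (M : Matrix (Fin d) (Fin d) ℝ) (x : E d) : ℝ :=
  dotProduct (WithLp.ofLp x) (M.mulVec (WithLp.ofLp x))

/-- Stage cost `ℓ(x, u) = ‖x‖_Q² + ‖u‖_R²`. -/
def stageCost {n m : ℕ} (Q : Matrix (Fin n) (Fin n) ℝ) (R : Matrix (Fin m) (Fin m) ℝ)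
    (x : E n) (u : E m) : ℝ :=
  weightedSq Q x + weightedSq R u

/-- `ℓ⋆(x) = min_{u ∈ U} ℓ(x, u)`. -/
def minStageCost {n m : ℕ} (Q : Matrix (Fin n) (Fin n) ℝ) (R : Matrix (Fin m) (Fin m) ℝ)
    (U : Set (E m)) (x : E n) : ℝ :=
  sInf ((fun u => stageCost Q R x u) '' U)

/-- The trajectory `x_u(k; x₀)` of `x⁺ = g(x, u)` under the control sequence `u`. -/
def traj {n m : ℕ} (g : E n → E m → E n) (u : ℕ → E m) (x₀ : E n) : ℕ → E n
  | 0 => x₀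
  | k + 1 => g (traj g u x₀ k) (u k)

/-- Admissible control sequences of length `N ∈ ℕ ∪ {∞}`: the first `N` entries lie in `U`
(the entries beyond `N` play no role). -/
def admissible {m : ℕ} (U : Set (E m)) (N : ℕ∞) : Set (ℕ → E m) :=
  {u | ∀ k : ℕ, (k : ℕ∞) < N → u k ∈ U}

/-- `J_N(x, u) = ∑_{k=0}^{N-1} ℓ(x_u(k; x), u(k))` for the dynamics `g`. -/
def costJ {n m : ℕ} (g : E n → E m → E n) (Q : Matrix (Fin n) (Fin n) ℝ)
    (R : Matrix (Fin m) (Fin m) ℝ) (N : ℕ) (x : E n) (u : ℕ → E m) : ℝ :=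
  ∑ k ∈ Finset.range N, stageCost Q R (traj g u x k) (u k)

/-- `V_N(x) = inf_{u ∈ 𝒰_N} J_N(x, u)` for the dynamics `g`. -/
def valueV {n m : ℕ} (g : E n → E m → E n) (U : Set (E m)) (Q : Matrix (Fin n) (Fin n) ℝ)
    (R : Matrix (Fin m) (Fin m) ℝ) (N : ℕ) (x : E n) : ℝ :=
  sInf ((fun u => costJ g Q R N x u) '' admissible U (N : ℕ∞))

/-- The sublevel set `{x ∈ ℝ^n | V_N(x) ≤ c}`. -/
def sublevel {n m : ℕ} (g : E n → E m → E n) (U : Set (E m)) (Q : Matrix (Fin n) (Fin n) ℝ)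
    (R : Matrix (Fin m) (Fin m) ℝ) (N : ℕ) (c : ℝ) : Set (E n) :=
  {x | valueV g U Q R N x ≤ c}

/-- `u` solves the optimal control problem with dynamics `g`, horizon `N`, initial state `x`. -/
def IsOptimal {n m : ℕ} (g : E n → E m → E n) (U : Set (E m)) (Q : Matrix (Fin n) (Fin n) ℝ)
    (R : Matrix (Fin m) (Fin m) ℝ) (N : ℕ) (x : E n) (u : ℕ → E m) : Prop :=
  u ∈ admissible U (N : ℕ∞) ∧ ∀ v ∈ admissible U (N : ℕ∞), costJ g Q R N x u ≤ costJ g Q R N x v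

/-- `μ` is an MPC feedback law on `Y` for the prediction model `g`: at every state of `Y`, it
returns the first element of an optimal control sequence. -/
def IsMPCFeedbackOn {n m : ℕ} (g : E n → E m → E n) (U : Set (E m))
    (Q : Matrix (Fin n) (Fin n) ℝ) (R : Matrix (Fin m) (Fin m) ℝ) (N : ℕ)
    (Y : Set (E n)) (μ : E n → E m) : Prop :=
  ∀ x ∈ Y, ∃ u, IsOptimal g U Q R N x u ∧ μ x = u 0

/-- The system `x⁺ = f(x, u)` is cost controllable on `S` with the sequence `B`. -/
def CostControllable {n m : ℕ} (f : E n → E m → E n) (U : Set (E m))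
    (Q : Matrix (Fin n) (Fin n) ℝ) (R : Matrix (Fin m) (Fin m) ℝ) (S : Set (E n))
    (B : ℕ → ℝ) : Prop :=
  (0 : E n) ∈ interior S ∧ Monotone B ∧ BddAbove (range B) ∧
    ∀ x ∈ S, ∃ u ∈ admissible U ⊤, (∀ k, traj f u x k ∈ S) ∧
      ∀ N : ℕ, 1 ≤ N →
        valueV f U Q R N x ≤ costJ f Q R N x u ∧
          costJ f Q R N x u ≤ B N * minStageCost Q R U x

/-- The suboptimality degree `α_N`, for `N ≥ 2`. -/
def alpha (B : ℕ → ℝ) (N : ℕ) : ℝ :=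
  1 - ((B 2 - 1) * (B N - 1) * ∏ i ∈ Finset.Icc 3 N, (B i - 1)) /
    ((∏ i ∈ Finset.Icc 2 N, B i) - (B 2 - 1) * ∏ i ∈ Finset.Icc 3 N, (B i - 1))

/-- Standing assumptions on the true system: input set convex, compact, with the origin in its
interior; `f` continuous on `ℝ^n × U` and locally Lipschitz in the state, uniformly in the
input; the origin is a controlled equilibrium. -/
structure StandingSystem {n m : ℕ} (f : E n → E m → E n) (U : Set (E m)) : Prop where
  convex : Convex ℝ U
  compact : IsCompact U
  zero_mem : (0 : E m) ∈ interior U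
  cont : ContinuousOn (fun p : E n × E m => f p.1 p.2) (univ ×ˢ U)
  locLip : ∀ K : Set (E n), IsCompact K →
    ∃ L : ℝ, ∀ x ∈ K, ∀ y ∈ K, ∀ u ∈ U, ‖f x u - f y u‖ ≤ L * ‖x - y‖
  equilibrium : f 0 0 = 0

/-- Proportional and uniform error bounds on `Ω` for the surrogates `fs ε`, `ε ∈ (0, εbar]`. -/
structure ErrorBounds {n m : ℕ} (f : E n → E m → E n) (fs : ℝ → E n → E m → E n)
    (U : Set (E m)) (Ω : Set (E n)) (εbar : ℝ) (cx cu η : ℝ → ℝ) : Prop where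
  zero_mem : (0 : E n) ∈ interior Ω
  proportional : ∀ ε ∈ Ioc 0 εbar, ∀ x ∈ Ω, ∀ u ∈ U,
    ‖f x u - fs ε x u‖ ≤ cx ε * ‖x‖ + cu ε * ‖u‖
  uniform : ∀ ε ∈ Ioc 0 εbar, ∀ x ∈ Ω, ∀ u ∈ U, ‖f x u - fs ε x u‖ ≤ η ε
  pos : ∀ ε ∈ Ioc 0 εbar, 0 < η ε
  tendsto_zero : Tendsto (fun ε => max (max (cx ε) (cu ε)) (η ε)) (𝓝[>] 0) (𝓝 0)

/-- Lipschitz continuity of the surrogates in the state on `Ω`, uniformly in the input, with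
constants bounded by `Lbar` for all `ε ∈ (0, εbar]`. -/
def UniformLipschitz {n m : ℕ} (fs : ℝ → E n → E m → E n) (U : Set (E m)) (Ω : Set (E n))
    (εbar : ℝ) (Lbar : NNReal) : Prop :=
  ∀ ε ∈ Ioc 0 εbar, ∃ L : NNReal, L ≤ Lbar ∧
    ∀ u ∈ U, LipschitzOnWith L (fun x => fs ε x u) Ω

/-- `r(N) = ∑_{i=0}^{N-1} Lbar^i`. -/
def radius (Lbar : NNReal) (N : ℕ) : ℝ := ∑ i ∈ Finset.range N, (Lbar : ℝ) ^ i

/-- Along every optimal prediction that starts in `Y`, the closed `ρ`-balls around the states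
at which the model `g` is evaluated in `J_N` (times `0, …, N - 2`) are contained in `Ω`. -/
def PredictionsInside {n m : ℕ} (g : E n → E m → E n) (U : Set (E m))
    (Q : Matrix (Fin n) (Fin n) ℝ) (R : Matrix (Fin m) (Fin m) ℝ) (N : ℕ)
    (Y : Set (E n)) (ρ : ℝ) (Ω : Set (E n)) : Prop :=
  ∀ x ∈ Y, ∀ u, IsOptimal g U Q R N x u →
    ∀ k : ℕ, k + 1 < N → Metric.closedBall (traj g u x k) ρ ⊆ Ω

/-- Class `𝒦` comparison functions on `[0, ∞)`. -/
structure IsClassK (a : ℝ → ℝ) : Prop where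
  cont : ContinuousOn a (Ici 0)
  strictMono : StrictMonoOn a (Ici 0)
  zero : a 0 = 0

/-- Class `𝒦ℒ` comparison functions, in discrete time. -/
structure IsClassKL (β : ℝ → ℕ → ℝ) : Prop where
  classK : ∀ k, IsClassK fun r => β r k
  antitone : ∀ r, 0 ≤ r → Antitone (β r)
  tendsto_zero : ∀ r, 0 ≤ r → Tendsto (β r) atTop (𝓝 0)

/-- The origin is asymptotically stable on `Y` for `x⁺ = g(x)`: `Y` is a forward invariant
neighbourhood of the origin, and a `𝒦ℒ` estimate holds for all trajectories starting in `Y`. -/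
def AsymptoticallyStableOn {n : ℕ} (g : E n → E n) (Y : Set (E n)) : Prop :=
  Y ∈ 𝓝 (0 : E n) ∧ MapsTo g Y Y ∧
    ∃ β : ℝ → ℕ → ℝ, IsClassKL β ∧ ∀ x ∈ Y, ∀ k : ℕ, ‖g^[k] x‖ ≤ β ‖x‖ k

/-- The minimal stage cost is `‖x‖_Q²`. -/
theorem minStageCost_eq {n m : ℕ} (Q : Matrix (Fin n) (Fin n) ℝ)
    (R : Matrix (Fin m) (Fin m) ℝ) (hR : R.PosDef) (U : Set (E m)) (hU : (0 : E m) ∈ U)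
    (x : E n) : minStageCost Q R U x = weightedSq Q x := by
  have h0 : weightedSq R (0 : E m) = 0 := by simp [weightedSq]
  refine IsLeast.csInf_eq ⟨⟨0, hU, by simp [stageCost, h0]⟩, ?_⟩
  rintro _ ⟨u, -, rfl⟩
  have h : 0 ≤ weightedSq R u := by
    simpa [weightedSq] using hR.posSemidef.dotProduct_mulVec_nonneg (WithLp.ofLp u)
  simpa [stageCost] using h

end SurrogateMPC

end

/-! The surrogate's optimal value is a Lyapunov function for the true closed loop. Let λ_0, …,
λ_{N-1} be the stage costs of an optimal prediction from x, and let z be the true successor of x. If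
the value at z failed to drop by a fixed fraction of λ_0, then replacing the tail of the prediction
after any time i could not help much either. Up to small errors this says V ≤ λ_1 + … + λ_i +
T_{N-i} λ_{i+1}, where T_k bounds the k-step value relative to ℓ⋆. Each such inequality shrinks the
gap between V and the partial sums of λ_1, λ_2, … by a factor 1 - 1/T_{N-i}. After N - 1 steps λ_0
itself is at most about T_N ∏_{i=2}^N (1 - 1/T_i) λ_0, and positivity of α_N makes this factor less
than one (`value_le_of_alternatives`).

The tail can only be replaced while the predicted state lies in S. If it has left S, its weighted
norm is bounded below: a sublevel set inside S contains the ellipsoid where the value bound is below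
c (`mem_sublevel_of_lt`). Hence V ≤ c is at most about T_N λ_{i+1}, and the gap still shrinks by the
same factor provided T_N ∏_{k<i≤N} (1 - 1/T_i) ≤ T_k for all k. This inequality can fail for B
itself. It holds for the bounds obtained from B by optimal concatenation
(`tightBound_mul_decay_le`), which remain valid for the values on S (`exists_viable_costJ_le`) and
do not exceed B.

The model error enters twice, in bounding surrogate costs by true costs along controls viable for f,
and in restarting a prediction at z. The uniform error keeps trajectories in Ω; the proportional
error makes every perturbation a small multiple of stage costs, so the decrease survives down to the
origin. -/

noncomputable section

namespace SurrogateMPC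

/-! ### Tightened controllability bounds and decay products -/

/-- The least bounds on `V_k / ℓ⋆` that follow from the bounds `B` by concatenating control
sequences. -/
def tightBound (B : ℕ → ℝ) : ℕ → ℝ
  -- The value at 0 is a default: all products below run over indices at least 1. The value at 1 is
  -- forced by V_1 = ℓ⋆.
  | 0 => 1
  | 1 => 1
  -- With p the product over the open interval, the quotient is the solution t of t (1 - (1 - 1/t)
  -- p) = B_j. The attached index set serves only the termination proof.
  | k + 2 => (Finset.Icc 2 (k + 2)).inf' (Finset.nonempty_Icc.2 (by omega)) fun j =>
      (B j - ∏ i ∈ (Finset.Ioo (k + 2 - j) (k + 2)).attach, (1 - 1 / tightBound B i.1)) /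
        (1 - ∏ i ∈ (Finset.Ioo (k + 2 - j) (k + 2)).attach, (1 - 1 / tightBound B i.1))
  decreasing_by
    all_goals exact (Finset.mem_Ioo.1 i.2).2

theorem tightBound_one (B : ℕ → ℝ) : tightBound B 1 = 1 := by
  rw [tightBound]

theorem tightBound_eq (B : ℕ → ℝ) {k : ℕ} (hk : 2 ≤ k) :
    tightBound B k = (Finset.Icc 2 k).inf' (Finset.nonempty_Icc.2 hk) fun j =>
      (B j - ∏ i ∈ Finset.Ioo (k - j) k, (1 - 1 / tightBound B i)) /
        (1 - ∏ i ∈ Finset.Ioo (k - j) k, (1 - 1 / tightBound B i)) := by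
  obtain ⟨k, rfl⟩ := Nat.exists_eq_add_of_le' hk
  rw [tightBound]
  refine Finset.inf'_congr _ rfl fun j _ => ?_
  rw [Finset.prod_attach _ (fun i => 1 - 1 / tightBound B i)]

/-- The product of the factors `1 - 1 / T_i` over `a < i ≤ b`. -/
def decay (T : ℕ → ℝ) (a b : ℕ) : ℝ := ∏ i ∈ Finset.Ioc a b, (1 - 1 / T i)

theorem decay_succ_left (T : ℕ → ℝ) {a b : ℕ} (h : a < b) :
    decay T a b = (1 - 1 / T (a + 1)) * decay T (a + 1) b := by
  have : Finset.Ioc a b = insert (a + 1) (Finset.Ioc (a + 1) b) := by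
    ext i; simp only [Finset.mem_Ioc, Finset.mem_insert]; omega
  rw [decay, this, Finset.prod_insert (by simp), decay]

theorem decay_self (T : ℕ → ℝ) (a : ℕ) : decay T a a = 1 := by simp [decay]

theorem decay_mul (T : ℕ → ℝ) {a b c : ℕ} (hab : a ≤ b) (hbc : b ≤ c) :
    decay T a b * decay T b c = decay T a c := by
  rw [decay, decay, decay, ← Finset.prod_union]
  · congr 1
    ext i; simp only [Finset.mem_union, Finset.mem_Ioc]; omega
  · rw [Finset.disjoint_left]
    intro i; simp only [Finset.mem_Ioc]; omega

theorem decay_eq_Ioo (T : ℕ → ℝ) {a b : ℕ} (h : a < b) :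
    decay T a b = (1 - 1 / T b) * ∏ i ∈ Finset.Ioo a b, (1 - 1 / T i) := by
  have : Finset.Ioc a b = insert b (Finset.Ioo a b) := by
    ext i; simp only [Finset.mem_Ioc, Finset.mem_Ioo, Finset.mem_insert]; omega
  rw [decay, this, Finset.prod_insert (by simp)]

theorem one_sub_one_div_mem {t : ℝ} (ht : 1 ≤ t) : 0 ≤ 1 - 1 / t ∧ 1 - 1 / t < 1 := by
  have h0 : 0 < t := by linarith
  have h1 : 1 / t ≤ 1 := by rw [div_le_one h0]; exact ht
  have h2 : 0 < 1 / t := by positivity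
  constructor <;> linarith

theorem decay_nonneg {T : ℕ → ℝ} {a b : ℕ} (hT : ∀ i, a < i → i ≤ b → 1 ≤ T i) :
    0 ≤ decay T a b :=
  Finset.prod_nonneg fun i hi => by
    have := Finset.mem_Ioc.1 hi
    exact (one_sub_one_div_mem (hT i this.1 this.2)).1

theorem prod_Ioo_mem {T : ℕ → ℝ} {a b : ℕ} (hab : a + 1 < b)
    (hT : ∀ i, a < i → i < b → 1 ≤ T i) :
    0 ≤ ∏ i ∈ Finset.Ioo a b, (1 - 1 / T i) ∧ ∏ i ∈ Finset.Ioo a b, (1 - 1 / T i) < 1 := by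
  have key : ∀ i ∈ Finset.Ioo a b, 0 ≤ 1 - 1 / T i ∧ 1 - 1 / T i < 1 := fun i hi => by
    have := Finset.mem_Ioo.1 hi
    exact one_sub_one_div_mem (hT i this.1 this.2)
  refine ⟨Finset.prod_nonneg fun i hi => (key i hi).1, ?_⟩
  have hmem : a + 1 ∈ Finset.Ioo a b := Finset.mem_Ioo.2 ⟨by omega, hab⟩
  rw [← Finset.mul_prod_erase _ _ hmem]
  have h1 : ∏ i ∈ (Finset.Ioo a b).erase (a + 1), (1 - 1 / T i) ≤ 1 :=
    Finset.prod_le_one (fun i hi => (key i (Finset.mem_of_mem_erase hi)).1)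
      fun i hi => (key i (Finset.mem_of_mem_erase hi)).2.le
  calc _ ≤ (1 - 1 / T (a + 1)) * 1 := mul_le_mul_of_nonneg_left h1 (key _ hmem).1
    _ < 1 := by rw [mul_one]; exact (key _ hmem).2

theorem one_lt_tightBound {B : ℕ → ℝ} (hB : ∀ j, 2 ≤ j → 1 < B j) :
    ∀ k, 2 ≤ k → 1 < tightBound B k := by
  intro k
  induction k using Nat.strong_induction_on with
  | _ k ih =>
    intro hk
    rw [tightBound_eq B hk, Finset.lt_inf'_iff]
    intro j hj
    rw [Finset.mem_Icc] at hj
    have hp := prod_Ioo_mem (T := tightBound B) (a := k - j) (b := k) (by omega) (by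
      intro i hi1 hi2
      rcases Nat.lt_or_ge i 2 with h | h
      · obtain rfl : i = 1 := by omega
        rw [tightBound_one]
      · exact (ih i hi2 h).le)
    rw [lt_div_iff₀ (by linarith [hp.2])]
    linarith [hB j hj.1]

theorem one_le_tightBound {B : ℕ → ℝ} (hB : ∀ j, 2 ≤ j → 1 < B j) {k : ℕ} (hk : 1 ≤ k) :
    1 ≤ tightBound B k := by
  rcases Nat.lt_or_ge k 2 with h | h
  · obtain rfl : k = 1 := by omega
    rw [tightBound_one]
  · exact (one_lt_tightBound hB k h).le

theorem mul_one_sub_decay {T : ℕ → ℝ} {a b : ℕ} (h : a < b) (hb : T b ≠ 0) :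
    T b * (1 - decay T a b) =
      T b * (1 - ∏ i ∈ Finset.Ioo a b, (1 - 1 / T i)) + ∏ i ∈ Finset.Ioo a b, (1 - 1 / T i) := by
  rw [decay_eq_Ioo T h]
  field_simp
  ring

/-- Each candidate in the defining minimum, cleared of its denominator. The optimal j attains
equality, as the next lemma records. -/
theorem tightBound_mul_le {B : ℕ → ℝ} (hB : ∀ j, 2 ≤ j → 1 < B j) {j k : ℕ} (hj : 2 ≤ j)
    (hjk : j ≤ k) : tightBound B k * (1 - decay (tightBound B) (k - j) k) ≤ B j := by
  have hk : 2 ≤ k := hj.trans hjk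
  have hp := prod_Ioo_mem (T := tightBound B) (a := k - j) (b := k) (by omega)
    fun i hi1 _ => one_le_tightBound hB (by omega)
  rw [mul_one_sub_decay (by omega) (by linarith [one_lt_tightBound hB k hk])]
  have h : tightBound B k ≤ _ :=
    (tightBound_eq B hk).trans_le (Finset.inf'_le _ (Finset.mem_Icc.2 ⟨hj, hjk⟩))
  rw [le_div_iff₀ (by linarith [hp.2])] at h
  linarith

theorem exists_tightBound_mul_eq {B : ℕ → ℝ} (hB : ∀ j, 2 ≤ j → 1 < B j) {k : ℕ} (hk : 2 ≤ k) :
    ∃ j, 2 ≤ j ∧ j ≤ k ∧ tightBound B k * (1 - decay (tightBound B) (k - j) k) = B j := by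
  obtain ⟨j, hj, h⟩ := Finset.exists_mem_eq_inf' (Finset.nonempty_Icc.2 hk) fun j =>
      (B j - ∏ i ∈ Finset.Ioo (k - j) k, (1 - 1 / tightBound B i)) /
        (1 - ∏ i ∈ Finset.Ioo (k - j) k, (1 - 1 / tightBound B i))
  rw [Finset.mem_Icc] at hj
  refine ⟨j, hj.1, hj.2, ?_⟩
  rw [← tightBound_eq B hk] at h
  have hp := prod_Ioo_mem (T := tightBound B) (a := k - j) (b := k) (by omega)
    fun i hi1 _ => one_le_tightBound hB (by omega)
  rw [mul_one_sub_decay (by omega) (by linarith [one_lt_tightBound hB k hk])]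
  rw [eq_div_iff (by linarith [hp.2])] at h
  linarith

/-- The factor at index 1 vanishes because T_1 = 1. Hence the choice j = k in the minimum gives B_k
itself. -/
theorem decay_tightBound_zero (B : ℕ → ℝ) {k : ℕ} (hk : 1 ≤ k) :
    decay (tightBound B) 0 k = 0 := by
  rw [decay_succ_left _ (by omega), zero_add, tightBound_one]
  simp

theorem tightBound_le {B : ℕ → ℝ} (hB : ∀ j, 2 ≤ j → 1 < B j) {k : ℕ} (hk : 2 ≤ k) :
    tightBound B k ≤ B k := by
  have := tightBound_mul_le hB hk le_rfl
  rwa [Nat.sub_self, decay_tightBound_zero B (by omega), sub_zero, mul_one] at this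

/-- The suboptimality condition for `B` passes to the tightened bounds. -/
theorem tightBound_mul_decay_lt_one {B : ℕ → ℝ} (hB : ∀ j, 2 ≤ j → 1 < B j) {N : ℕ} (hN : 2 ≤ N)
    (h : B N * ∏ i ∈ Finset.Icc 2 N, (B i - 1) < ∏ i ∈ Finset.Icc 2 N, B i) :
    tightBound B N * decay (tightBound B) 1 N < 1 := by
  have hset : Finset.Ioc 1 N = Finset.Icc 2 N := by
    ext i; simp only [Finset.mem_Ioc, Finset.mem_Icc]; omega
  have hle : decay (tightBound B) 1 N ≤ decay B 1 N := by
    refine Finset.prod_le_prod (fun i hi => ?_) fun i hi => ?_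
    · rw [Finset.mem_Ioc] at hi
      exact (one_sub_one_div_mem (one_le_tightBound hB (by omega))).1
    · rw [Finset.mem_Ioc] at hi
      have h1 := one_lt_tightBound hB i (by omega)
      have := one_div_le_one_div_of_le (by linarith) (tightBound_le hB (k := i) (by omega))
      linarith
  have hpos : 0 < ∏ i ∈ Finset.Icc 2 N, B i := Finset.prod_pos fun i hi => by
    rw [Finset.mem_Icc] at hi
    linarith [hB i hi.1]
  have hd : decay B 1 N = (∏ i ∈ Finset.Icc 2 N, (B i - 1)) / ∏ i ∈ Finset.Icc 2 N, B i := by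
    rw [decay, hset, ← Finset.prod_div_distrib]
    refine Finset.prod_congr rfl fun i hi => ?_
    rw [Finset.mem_Icc] at hi
    have := hB i hi.1
    field_simp
  have h1 : B N * decay B 1 N < 1 := by
    rw [hd, ← mul_div_assoc, div_lt_one hpos]
    exact h
  refine lt_of_le_of_lt (mul_le_mul (tightBound_le hB hN) hle ?_ ?_) h1
  · exact decay_nonneg fun i hi _ => one_le_tightBound hB (by omega)
  · linarith [hB N hN]

/-- Under the suboptimality condition, `T_N ∏_{k < i ≤ N} (1 - 1 / T_i) ≤ T_k` for every `k`. -/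
theorem tightBound_mul_decay_le {B : ℕ → ℝ} (hB : ∀ j, 2 ≤ j → 1 < B j) {N : ℕ} (hN : 2 ≤ N)
    (h : tightBound B N * decay (tightBound B) 1 N < 1) {k : ℕ} (hk : 1 ≤ k) (hkN : k ≤ N) :
    tightBound B N * decay (tightBound B) k N ≤ tightBound B k := by
  set T := tightBound B with hT
  have hT1 : ∀ i, 1 ≤ i → 1 ≤ T i := fun i hi => one_le_tightBound hB hi
  set Y : ℕ → ℝ := fun k => T N * decay T k N with hY
  set ρ : ℕ → ℝ := fun k => Y k / T k with hρ
  have hY0 : ∀ i, 0 ≤ Y i := fun i =>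
    mul_nonneg (by linarith [hT1 N (by omega)]) (decay_nonneg fun l hl _ => hT1 l (by omega))
  have hYρ : ∀ i, 1 ≤ i → Y i = ρ i * T i := fun i hi => by
    have := hT1 i hi
    simp only [hρ]; field_simp
  have hstep : ∀ i, i < N → Y i = Y (i + 1) - ρ (i + 1) := fun i hi => by
    have := hT1 (i + 1) (by omega)
    simp only [hρ, hY]
    rw [decay_succ_left T hi]
    field_simp
  have hwin : ∀ i j, 1 ≤ i → i ≤ N → Y i - Y (i - j) = ρ i * (T i * (1 - decay T (i - j) i)) := by
    intro i j hi hiN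
    rw [← mul_assoc, ← hYρ i hi]
    simp only [hY]
    rw [← decay_mul T (Nat.sub_le i j) hiN]
    ring
  have hρN : ρ N = 1 := by
    have := hT1 N (by omega)
    simp only [hρ, hY, decay_self, mul_one]
    field_simp
  have hρ1 : ρ 1 < 1 := by
    simp only [hρ, hY]
    rw [hT, tightBound_one, div_one]
    exact h
  -- Otherwise let K be the last maximizer of ρ. The endpoint values ρ_1 < 1 and ρ_N = 1 place K
  -- strictly between 1 and N, so ρ drops strictly after K.
  have hmain : ∀ i ∈ Finset.Icc 1 N, ρ i ≤ 1 := by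
    by_contra! hcon
    obtain ⟨i₀, hi₀, hi₀'⟩ := hcon
    obtain ⟨M, hM, hMmax⟩ := Finset.exists_max_image (Finset.Icc 1 N) ρ ⟨i₀, hi₀⟩
    set F := (Finset.Icc 1 N).filter fun i => ρ i = ρ M with hF
    have hFne : F.Nonempty := ⟨M, by simp [hF, Finset.mem_Icc.1 hM]⟩
    set K := F.max' hFne with hK
    have hKF : K ∈ F := F.max'_mem hFne
    obtain ⟨hK1, hKM⟩ := Finset.mem_filter.1 hKF
    rw [Finset.mem_Icc] at hK1
    have hbig : 1 < ρ K := by rw [hKM]; exact hi₀'.trans_le (hMmax i₀ hi₀)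
    have hKN : K < N := lt_of_le_of_ne hK1.2 fun h => by rw [h, hρN] at hbig; exact lt_irrefl _ hbig
    have hK2 : 2 ≤ K := by
      by_contra hlt
      have : K = 1 := by omega
      rw [this] at hbig
      linarith
    have hnext : ρ (K + 1) < ρ K := by
      refine lt_of_le_of_ne ?_ fun heq => ?_
      · rw [hKM]; exact hMmax _ (Finset.mem_Icc.2 ⟨by omega, hKN⟩)
      · have : K + 1 ∈ F := by
          rw [hF, Finset.mem_filter, Finset.mem_Icc]
          exact ⟨⟨by omega, hKN⟩, heq.trans hKM⟩
        have := F.le_max' _ this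
        omega
    -- The window length j that is tight at K is still admissible at K + 1. Subtracting the two
    -- window relations gives ρ_{K+1} - ρ_K ≤ (ρ_{K+1} - ρ_K) B_j; as the difference is negative,
    -- this contradicts B_j > 1.
    obtain ⟨j, hj2, hjK, hj⟩ := exists_tightBound_mul_eq hB hK2
    have hle := tightBound_mul_le hB hj2 (k := K + 1) (by omega)
    have e1 := hwin K j (by omega) (by omega)
    have e2 := hwin (K + 1) j (by omega) (by omega)
    rw [← hT] at hj hle
    rw [hj] at e1
    have e3 := hstep K hKN
    have e4 := hstep (K - j) (by omega)
    have e5 : K + 1 - j = K - j + 1 := by omega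
    have hρ0 : 0 ≤ ρ (K + 1) := div_nonneg (hY0 _) (by linarith [hT1 (K + 1) (by omega)])
    have e6 := mul_le_mul_of_nonneg_left hle hρ0
    rw [← e2, e5] at e6
    have e7 : ρ (K - j + 1) ≤ ρ K := by
      rw [hKM]; exact hMmax _ (Finset.mem_Icc.2 ⟨by omega, by omega⟩)
    have hBj := hB j hj2
    nlinarith
  have := hmain k (Finset.mem_Icc.2 ⟨hk, hkN⟩)
  simp only [hρ] at this
  rwa [div_le_one (by linarith [hT1 k hk])] at this

/-- If each increment of the partial sums of `c` is large relative to the remaining gap to `κ`, or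
relative to `κ` itself, then the gap decays. -/
theorem sub_sum_le_mul_decay {T c : ℕ → ℝ} {κ : ℝ} {N : ℕ} (hκ : 0 ≤ κ) :
    ∀ j, j ≤ N → (∀ i, N - j < i → i ≤ N → 1 ≤ T i) →
      (∀ i < j, κ ≤ ∑ l ∈ Finset.range i, c l + T (N - i) * c i ∨
        (T N * decay T (N - i) N ≤ T (N - i) ∧ κ ≤ T N * c i)) →
      κ - ∑ l ∈ Finset.range j, c l ≤ κ * decay T (N - j) N := by
  intro j
  induction j with
  | zero => intro _ _ _; simp [decay_self]
  | succ j ih =>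
    intro hjN hT hstep
    have hprev := ih (by omega) (fun i hi => hT i (by omega)) fun i hi => hstep i (by omega)
    have hTj : 1 ≤ T (N - j) := hT _ (by omega) (by omega)
    have hTN : 1 ≤ T N := hT _ (by omega) le_rfl
    rw [Finset.sum_range_succ, decay_succ_left T (by omega : N - (j + 1) < N)]
    have he : N - (j + 1) + 1 = N - j := by omega
    rw [he]
    set s := ∑ l ∈ Finset.range j, c l
    set D := decay T (N - j) N
    have hT0 : 0 < T (N - j) := by linarith
    rcases hstep j (by omega) with h | ⟨h1, h2⟩
    · have h3 : (κ - s) / T (N - j) ≤ c j := by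
        rw [div_le_iff₀ hT0]; linarith
      have h4 := mul_le_mul_of_nonneg_left hprev (one_sub_one_div_mem hTj).1
      have h5 : (1 - 1 / T (N - j)) * (κ - s) = κ - s - (κ - s) / T (N - j) := by ring
      nlinarith
    -- The increment is at least κ / T_N, hence at least the share κD / T_{N-j} by which the bound
    -- κD has to shrink.
    · have h3 : κ / T N ≤ c j := by
        rw [div_le_iff₀ (by linarith)]; linarith
      have h4 : κ * D / T (N - j) ≤ κ / T N := by
        rw [div_le_div_iff₀ hT0 (by linarith)]
        nlinarith
      have h5 : κ * ((1 - 1 / T (N - j)) * D) = κ * D - κ * D / T (N - j) := by ring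
      linarith

/-! ### Quadratic forms and stage costs -/

theorem continuous_weightedSq {d : ℕ} (M : Matrix (Fin d) (Fin d) ℝ) :
    Continuous (weightedSq M) := by
  unfold weightedSq dotProduct Matrix.mulVec dotProduct
  fun_prop

theorem weightedSq_smul {d : ℕ} (M : Matrix (Fin d) (Fin d) ℝ) (t : ℝ) (x : E d) :
    weightedSq M (t • x) = t ^ 2 * weightedSq M x := by
  simp only [weightedSq, WithLp.ofLp_smul, Matrix.mulVec_smul, smul_dotProduct, dotProduct_smul,
    smul_eq_mul]
  ring

theorem weightedSq_zero {d : ℕ} (M : Matrix (Fin d) (Fin d) ℝ) : weightedSq M (0 : E d) = 0 := by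
  simp [weightedSq]

theorem weightedSq_nonneg {d : ℕ} {M : Matrix (Fin d) (Fin d) ℝ} (hM : M.PosDef) (x : E d) :
    0 ≤ weightedSq M x := by
  simpa [weightedSq] using hM.posSemidef.dotProduct_mulVec_nonneg (WithLp.ofLp x)

theorem weightedSq_pos {d : ℕ} {M : Matrix (Fin d) (Fin d) ℝ} (hM : M.PosDef) {x : E d}
    (hx : x ≠ 0) : 0 < weightedSq M x := by
  have hx' : WithLp.ofLp x ≠ 0 := fun h => hx (by ext i; simp [h])
  simpa [weightedSq] using hM.dotProduct_mulVec_pos hx'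

theorem weightedSq_eq_norm_sq_mul {d : ℕ} (M : Matrix (Fin d) (Fin d) ℝ) {x : E d} (hx : x ≠ 0) :
    weightedSq M x = ‖x‖ ^ 2 * weightedSq M (‖x‖⁻¹ • x) := by
  have : ‖x‖ ≠ 0 := norm_ne_zero_iff.2 hx
  rw [weightedSq_smul]
  field_simp

theorem exists_mul_norm_sq_le {d : ℕ} {M : Matrix (Fin d) (Fin d) ℝ} (hM : M.PosDef) :
    ∃ q > 0, ∀ x : E d, q * ‖x‖ ^ 2 ≤ weightedSq M x := by
  rcases (Metric.sphere (0 : E d) 1).eq_empty_or_nonempty with h | h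
  · refine ⟨1, one_pos, fun x => ?_⟩
    have : x = 0 := by
      by_contra hx
      exact h.subset (show ‖x‖⁻¹ • x ∈ Metric.sphere (0 : E d) 1 by
        simp [norm_smul, norm_ne_zero_iff.2 hx])
    simp [this, weightedSq_zero]
  · obtain ⟨z, hz, hmin⟩ := (isCompact_sphere (0 : E d) 1).exists_isMinOn h
      (continuous_weightedSq M).continuousOn
    refine ⟨weightedSq M z, weightedSq_pos hM (by rintro rfl; simp at hz), fun x => ?_⟩
    rcases eq_or_ne x 0 with rfl | hx
    · simp [weightedSq_zero]
    · rw [weightedSq_eq_norm_sq_mul M hx, mul_comm]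
      refine mul_le_mul_of_nonneg_left (isMinOn_iff.1 hmin _ ?_) (by positivity)
      simp [norm_smul, norm_ne_zero_iff.2 hx]

theorem exists_le_mul_norm_sq {d : ℕ} (M : Matrix (Fin d) (Fin d) ℝ) :
    ∃ C > 0, ∀ x : E d, weightedSq M x ≤ C * ‖x‖ ^ 2 := by
  obtain ⟨C, hC⟩ := (isCompact_sphere (0 : E d) 1).bddAbove_image
    (continuous_weightedSq M).continuousOn
  refine ⟨max C 1, by positivity, fun x => ?_⟩
  rcases eq_or_ne x 0 with rfl | hx
  · simp [weightedSq_zero]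
  · rw [weightedSq_eq_norm_sq_mul M hx, mul_comm]
    refine mul_le_mul_of_nonneg_right (le_max_of_le_left (hC ⟨_, ?_, rfl⟩)) (by positivity)
    simp [norm_smul, norm_ne_zero_iff.2 hx]

/-- Young's inequality with its remainder: the cross terms cancel, and no symmetry of M is needed.
-/
theorem weightedSq_parallelogram {d : ℕ} {M : Matrix (Fin d) (Fin d) ℝ} (s : ℝ) (x v : E d) :
    s * weightedSq M (x + v) + weightedSq M (s • x - v) =
      s * (1 + s) * weightedSq M x + (1 + s) * weightedSq M v := by
  simp only [weightedSq, WithLp.ofLp_smul, WithLp.ofLp_add, WithLp.ofLp_sub, Matrix.mulVec_smul,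
    Matrix.mulVec_add, Matrix.mulVec_sub, smul_dotProduct, dotProduct_smul, smul_eq_mul,
    add_dotProduct, dotProduct_add, sub_dotProduct, dotProduct_sub]
  ring

theorem weightedSq_le_of_sub {d : ℕ} {M : Matrix (Fin d) (Fin d) ℝ} (hM : M.PosDef) {s : ℝ}
    (hs : 0 < s) (x y : E d) :
    weightedSq M y ≤ (1 + s) * weightedSq M x + (1 + 1 / s) * weightedSq M (y - x) := by
  have h1 := weightedSq_parallelogram (M := M) s x (y - x)
  have h2 := weightedSq_nonneg hM (s • x - (y - x))
  rw [add_sub_cancel] at h1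
  have h3 : s * weightedSq M y ≤
      s * ((1 + s) * weightedSq M x + (1 + 1 / s) * weightedSq M (y - x)) := by
    have : s * ((1 + 1 / s) * weightedSq M (y - x)) = (1 + s) * weightedSq M (y - x) := by
      field_simp
      ring
    rw [mul_add, this]
    linarith
  exact le_of_mul_le_mul_left h3 hs

section Cost

variable {n m : ℕ} {Q : Matrix (Fin n) (Fin n) ℝ} {R : Matrix (Fin m) (Fin m) ℝ}

theorem weightedSq_le_stageCost (hR : R.PosDef) (x : E n) (u : E m) :
    weightedSq Q x ≤ stageCost Q R x u := by
  unfold stageCost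
  linarith [weightedSq_nonneg hR u]

theorem stageCost_nonneg (hQ : Q.PosDef) (hR : R.PosDef) (x : E n) (u : E m) :
    0 ≤ stageCost Q R x u :=
  add_nonneg (weightedSq_nonneg hQ x) (weightedSq_nonneg hR u)

theorem exists_norm_add_norm_sq_le (hQ : Q.PosDef) (hR : R.PosDef) :
    ∃ C > 0, ∀ (x : E n) (u : E m), (‖x‖ + ‖u‖) ^ 2 ≤ C * stageCost Q R x u := by
  obtain ⟨q, hq, hq'⟩ := exists_mul_norm_sq_le hQ
  obtain ⟨r, hr, hr'⟩ := exists_mul_norm_sq_le hR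
  refine ⟨2 / q + 2 / r, by positivity, fun x u => ?_⟩
  have h1 : ‖x‖ ^ 2 ≤ weightedSq Q x / q := by rw [le_div_iff₀ hq]; linarith [hq' x]
  have h2 : ‖u‖ ^ 2 ≤ weightedSq R u / r := by rw [le_div_iff₀ hr]; linarith [hr' u]
  have h3 : 0 ≤ weightedSq R u / q := div_nonneg (weightedSq_nonneg hR u) hq.le
  have h4 : 0 ≤ weightedSq Q x / r := div_nonneg (weightedSq_nonneg hQ x) hr.le
  have h5 : (2 / q + 2 / r) * stageCost Q R x u = 2 * (weightedSq Q x / q) +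
      2 * (weightedSq R u / q) + 2 * (weightedSq Q x / r) + 2 * (weightedSq R u / r) := by
    unfold stageCost; ring
  nlinarith [sq_nonneg (‖x‖ - ‖u‖)]

/-! ### Costs, values and concatenated controls -/

theorem costJ_nonneg (hQ : Q.PosDef) (hR : R.PosDef) (g : E n → E m → E n) (N : ℕ) (x : E n)
    (u : ℕ → E m) : 0 ≤ costJ g Q R N x u :=
  Finset.sum_nonneg fun _ _ => stageCost_nonneg hQ hR _ _

theorem costJ_mono (hQ : Q.PosDef) (hR : R.PosDef) (g : E n → E m → E n) {j k : ℕ} (h : j ≤ k)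
    (x : E n) (u : ℕ → E m) : costJ g Q R j x u ≤ costJ g Q R k x u :=
  Finset.sum_le_sum_of_subset_of_nonneg (Finset.range_subset_range.2 h)
    fun _ _ _ => stageCost_nonneg hQ hR _ _

theorem stageCost_le_costJ (hQ : Q.PosDef) (hR : R.PosDef) (g : E n → E m → E n) {k N : ℕ}
    (h : k < N) (x : E n) (u : ℕ → E m) :
    stageCost Q R (traj g u x k) (u k) ≤ costJ g Q R N x u :=
  Finset.single_le_sum (f := fun k => stageCost Q R (traj g u x k) (u k))
    (fun _ _ => stageCost_nonneg hQ hR _ _) (Finset.mem_range.2 h)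

theorem valueV_le (hQ : Q.PosDef) (hR : R.PosDef) {g : E n → E m → E n} {U : Set (E m)} {N : ℕ}
    {x : E n} {u : ℕ → E m} (hu : u ∈ admissible U (N : ℕ∞)) :
    valueV g U Q R N x ≤ costJ g Q R N x u := by
  refine csInf_le ⟨0, ?_⟩ ⟨u, hu, rfl⟩
  rintro _ ⟨v, -, rfl⟩
  exact costJ_nonneg hQ hR g N x v

theorem IsOptimal.costJ_eq {g : E n → E m → E n} {U : Set (E m)} {N : ℕ} {x : E n} {u : ℕ → E m}
    (h : IsOptimal g U Q R N x u) : valueV g U Q R N x = costJ g Q R N x u := by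
  refine IsLeast.csInf_eq ⟨⟨u, h.1, rfl⟩, ?_⟩
  rintro _ ⟨v, hv, rfl⟩
  exact h.2 v hv

theorem admissible_of_top {U : Set (E m)} {u : ℕ → E m} (hu : u ∈ admissible U ⊤) (N : ℕ) :
    u ∈ admissible U (N : ℕ∞) :=
  fun k _ => hu k (WithTop.coe_lt_top k)

theorem mem_of_admissible_top {U : Set (E m)} {u : ℕ → E m} (hu : u ∈ admissible U ⊤) (k : ℕ) :
    u k ∈ U :=
  hu k (WithTop.coe_lt_top k)

/-- The control sequence that applies the first `i` entries of `u`, and then `v`. -/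
def concat (i : ℕ) (u v : ℕ → E m) : ℕ → E m := fun k => if k < i then u k else v (k - i)

theorem concat_of_lt {i k : ℕ} (u v : ℕ → E m) (h : k < i) : concat i u v k = u k := if_pos h

theorem concat_add (i k : ℕ) (u v : ℕ → E m) : concat i u v (i + k) = v k := by
  simp [concat]

theorem traj_congr (g : E n → E m → E n) {u v : ℕ → E m} (x : E n) {k : ℕ}
    (h : ∀ i < k, u i = v i) : traj g u x k = traj g v x k := by
  induction k with
  | zero => rfl
  | succ k ih =>
    rw [traj, traj, ih fun i hi => h i (by omega), h k (by omega)]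

theorem traj_concat_of_le (g : E n → E m → E n) (u v : ℕ → E m) (x : E n) {i k : ℕ} (h : k ≤ i) :
    traj g (concat i u v) x k = traj g u x k :=
  traj_congr g x fun _ hl => concat_of_lt u v (by omega)

theorem traj_concat_add (g : E n → E m → E n) (u v : ℕ → E m) (x : E n) (i k : ℕ) :
    traj g (concat i u v) x (i + k) = traj g v (traj g u x i) k := by
  induction k with
  | zero => exact traj_concat_of_le g u v x le_rfl
  | succ k ih => rw [← add_assoc, traj, traj, ih, concat_add]

theorem costJ_concat (g : E n → E m → E n) (i k : ℕ) (x : E n) (u v : ℕ → E m) :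
    costJ g Q R (i + k) x (concat i u v) =
      costJ g Q R i x u + costJ g Q R k (traj g u x i) v := by
  unfold costJ
  rw [Finset.sum_range_add]
  congr 1
  · refine Finset.sum_congr rfl fun l hl => ?_
    rw [Finset.mem_range] at hl
    rw [traj_concat_of_le g u v x hl.le, concat_of_lt u v hl]
  · refine Finset.sum_congr rfl fun l _ => ?_
    rw [traj_concat_add, concat_add]

theorem concat_mem_admissible {U : Set (E m)} {i N : ℕ} {u v : ℕ → E m} (hu : ∀ k < i, u k ∈ U)
    (hv : ∀ k, i + k < N → v k ∈ U) : concat i u v ∈ admissible U (N : ℕ∞) := by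
  intro k hk
  rw [Nat.cast_lt] at hk
  rcases lt_or_ge k i with h | h
  · rw [concat_of_lt u v h]; exact hu k h
  · obtain ⟨l, rfl⟩ := Nat.exists_eq_add_of_le h
    rw [concat_add]; exact hv l hk

theorem concat_mem_admissible_top {U : Set (E m)} {i : ℕ} {u v : ℕ → E m}
    (hu : u ∈ admissible U ⊤) (hv : v ∈ admissible U ⊤) : concat i u v ∈ admissible U ⊤ := by
  intro k _
  rcases lt_or_ge k i with h | h
  · rw [concat_of_lt u v h]; exact mem_of_admissible_top hu k
  · obtain ⟨l, rfl⟩ := Nat.exists_eq_add_of_le h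
    rw [concat_add]; exact mem_of_admissible_top hv l

theorem stageCost_le_of_sub (hQ : Q.PosDef) {C s e : ℝ} (hs : 0 < s)
    (hC : ∀ x : E n, weightedSq Q x ≤ C * ‖x‖ ^ 2) (hC0 : 0 ≤ C) {x y : E n} (u : E m)
    (hR : R.PosDef) (h : ‖y - x‖ ^ 2 ≤ e) :
    stageCost Q R y u ≤ (1 + s) * stageCost Q R x u + (1 + 1 / s) * C * e := by
  have h1 := weightedSq_le_of_sub hQ hs x y
  have h2 := (hC (y - x)).trans (mul_le_mul_of_nonneg_left h hC0)
  have h3 : (1 + 1 / s) * weightedSq Q (y - x) ≤ (1 + 1 / s) * (C * e) :=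
    mul_le_mul_of_nonneg_left h2 (by positivity)
  have h4 := mul_nonneg hs.le (weightedSq_nonneg hR u)
  unfold stageCost
  linarith

end Cost

/-! ### Propagation of trajectory errors -/

/-- Growth constants of squared trajectory errors. -/
def errConst (L C : ℝ) : ℕ → ℝ
  | 0 => 1
  | k + 1 => 2 * L ^ 2 * errConst L C k + 2 * C

theorem errConst_nonneg (L : ℝ) {C : ℝ} (hC : 0 ≤ C) : ∀ k, 0 ≤ errConst L C k
  | 0 => zero_le_one
  | k + 1 => by
    have := errConst_nonneg L hC k
    rw [errConst]; positivity

/-- Squaring the recursion with (p + q)² ≤ 2p² + 2q² turns the proportional error into stage costs,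
so the accumulated error is measured by the cost itself. -/
theorem sq_le_errConst {L C γ : ℝ} {e a s : ℕ → ℝ} (hC : 0 ≤ C)
    (he : ∀ k, 0 ≤ e k) (hs : ∀ k, 0 ≤ s k) (has : ∀ k, a k ^ 2 ≤ C * s k) :
    ∀ k, (∀ i < k, e (i + 1) ≤ L * e i + γ * a i) →
      e k ^ 2 ≤ errConst L C k * (e 0 ^ 2 + γ ^ 2 * ∑ i ∈ Finset.range k, s i) := by
  intro k
  induction k with
  | zero => intro _; simp [errConst]
  | succ k ih =>
    intro hstep
    have h1 := ih fun i hi => hstep i (by omega)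
    have h2 := hstep k (by omega)
    have h3 : e (k + 1) ^ 2 ≤ 2 * L ^ 2 * e k ^ 2 + 2 * γ ^ 2 * a k ^ 2 := by
      have := pow_le_pow_left₀ (he (k + 1)) h2 2
      nlinarith [sq_nonneg (L * e k - γ * a k)]
    rw [Finset.sum_range_succ, errConst]
    set σ := ∑ i ∈ Finset.range k, s i
    have hσ : 0 ≤ σ := Finset.sum_nonneg fun i _ => hs i
    have hD := errConst_nonneg L hC k
    set D := errConst L C k
    have h4 : 2 * L ^ 2 * e k ^ 2 ≤ 2 * L ^ 2 * (D * (e 0 ^ 2 + γ ^ 2 * σ)) :=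
      mul_le_mul_of_nonneg_left h1 (by positivity)
    have h5 : 2 * γ ^ 2 * a k ^ 2 ≤ 2 * γ ^ 2 * (C * s k) :=
      mul_le_mul_of_nonneg_left (has k) (by positivity)
    have h6 : 0 ≤ 2 * L ^ 2 * D * (γ ^ 2 * s k) := by have := hs k; positivity
    have h7 : 0 ≤ 2 * C * (e 0 ^ 2 + γ ^ 2 * σ) := by positivity
    nlinarith

theorem radius_mono (L : NNReal) {j k : ℕ} (h : j ≤ k) : radius L j ≤ radius L k :=
  Finset.sum_le_sum_of_subset_of_nonneg (Finset.range_subset_range.2 h)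
    fun _ _ _ => by positivity

theorem radius_succ (L : NNReal) (k : ℕ) : radius L (k + 1) = L * radius L k + 1 := by
  unfold radius
  rw [Finset.sum_range_succ', Finset.mul_sum, pow_zero]
  congr 1
  exact Finset.sum_congr rfl fun i _ => by ring

theorem pow_le_radius (L : NNReal) {k N : ℕ} (h : k < N) : (L : ℝ) ^ k ≤ radius L N :=
  Finset.single_le_sum (f := fun i => (L : ℝ) ^ i) (fun _ _ => by positivity)
    (Finset.mem_range.2 h)

theorem radius_nonneg (L : NNReal) (k : ℕ) : 0 ≤ radius L k :=
  Finset.sum_nonneg fun _ _ => by positivity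

variable {n m : ℕ} {Q : Matrix (Fin n) (Fin n) ℝ} {R : Matrix (Fin m) (Fin m) ℝ}

/-! ### The tightened bounds are attained by viable controls -/

/-- The controllability bounds `B` on a viable set `S` can be replaced by `tightBound B`, at the
price of a control sequence that depends on the horizon. -/
theorem exists_viable_costJ_le (hQ : Q.PosDef) (hR : R.PosDef) {f : E n → E m → E n}
    {U : Set (E m)} {S : Set (E n)} {B : ℕ → ℝ} (hB : ∀ j, 2 ≤ j → 1 < B j)
    (hcc : ∀ x ∈ S, ∃ u ∈ admissible U ⊤, (∀ k, traj f u x k ∈ S) ∧ ∀ k, 2 ≤ k →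
      costJ f Q R k x u ≤ B k * weightedSq Q x ∧
        (0 < weightedSq Q x → costJ f Q R k x u < B k * weightedSq Q x)) :
    ∀ k, 2 ≤ k → ∀ x ∈ S, ∃ u ∈ admissible U ⊤, (∀ i, traj f u x i ∈ S) ∧
      costJ f Q R k x u ≤ tightBound B k * weightedSq Q x := by
  intro k
  induction k using Nat.strong_induction_on with
  | _ k ih =>
    intro hk x hx
    obtain ⟨u, hu, huS, hucost⟩ := hcc x hx
    set w := weightedSq Q x with hw
    rcases (weightedSq_nonneg hQ x).eq_or_lt with hw0 | hw0
    · refine ⟨u, hu, huS, ?_⟩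
      have := (hucost k hk).1
      rw [hw, ← hw0, mul_zero] at this ⊢
      exact this
    obtain ⟨j, hj2, hjk, hj⟩ := exists_tightBound_mul_eq hB hk
    rcases hjk.eq_or_lt with rfl | hjk
    · refine ⟨u, hu, huS, ?_⟩
      rw [Nat.sub_self, decay_tightBound_zero B (by omega), sub_zero, mul_one] at hj
      rw [hj]
      exact (hucost j hk).1
    by_contra hcon
    push Not at hcon
    have hT : ∀ i, 1 ≤ i → 1 ≤ tightBound B i := fun i hi => one_le_tightBound hB hi
    have hTk := hT k (by omega)
    -- If every viable control costs more than T_k w, then so does following u for i steps and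
    -- continuing optimally in the sense of the induction hypothesis. Since i < j < k, at least two
    -- steps remain for the continuation.
    have key := sub_sum_le_mul_decay (T := tightBound B)
      (c := fun i => stageCost Q R (traj f u x i) (u i)) (κ := tightBound B k * w) (N := k)
      (mul_nonneg (by linarith) hw0.le) j hjk.le (fun i hi _ => hT i (by omega)) (by
        intro i hi
        left
        rcases Nat.eq_zero_or_pos i with rfl | hi0
        · simp only [Finset.range_zero, Finset.sum_empty, zero_add, Nat.sub_zero]
          exact mul_le_mul_of_nonneg_left (weightedSq_le_stageCost hR _ _) (by linarith)
        · obtain ⟨v, hv, hvS, hvcost⟩ := ih (k - i) (by omega) (by omega) _ (huS i)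
          have h1 := hcon (concat i u v) (concat_mem_admissible_top hu hv) (by
            intro l
            rcases le_total l i with h | h
            · rw [traj_concat_of_le f u v x h]; exact huS l
            · obtain ⟨l, rfl⟩ := Nat.exists_eq_add_of_le h
              rw [traj_concat_add]; exact hvS l)
          have h2 := costJ_concat (Q := Q) (R := R) f i (k - i) x u v
          rw [Nat.add_sub_cancel' (by omega)] at h2
          have h3 := mul_le_mul_of_nonneg_left
            (weightedSq_le_stageCost (Q := Q) hR (traj f u x i) (u i))
            (zero_le_one.trans (hT (k - i) (by omega)))
          simp only [costJ] at h1 h2 hvcost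
          linarith)
    -- The gap estimate gives J_j ≥ T_k (1 - decay) w = B_j w, against the strict bound.
    have h1 := (hucost j hj2).2 hw0
    rw [← hj] at h1
    simp only [costJ] at h1
    nlinarith

/-! ### Surrogate models and perturbed predictions -/

/-- The model `g` approximates `f` with uniform error `η` and proportional error `γ`, is
Lipschitz on `Ω`, and `Ω` contains a neighbourhood of `S` that is large enough for the horizon. -/
structure IsSurrogate (f g : E n → E m → E n) (U : Set (E m)) (S Ω : Set (E n)) (η γ : ℝ)
    (L : NNReal) (N : ℕ) : Prop where
  pos : 0 < η
  uniform : ∀ x ∈ Ω, ∀ u ∈ U, ‖f x u - g x u‖ ≤ η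
  proportional : ∀ x ∈ Ω, ∀ u ∈ U, ‖f x u - g x u‖ ≤ γ * (‖x‖ + ‖u‖)
  lipschitz : ∀ u ∈ U, ∀ x ∈ Ω, ∀ y ∈ Ω, ‖g x u - g y u‖ ≤ L * ‖x - y‖
  incl : ∀ x ∈ S, ∀ y, ‖y - x‖ ≤ radius L N * η → y ∈ Ω

namespace IsSurrogate

variable {f g : E n → E m → E n} {U : Set (E m)} {S Ω : Set (E n)} {η γ : ℝ} {L : NNReal} {N : ℕ}

theorem subset (h : IsSurrogate f g U S Ω η γ L N) : S ⊆ Ω := fun x hx =>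
  h.incl x hx x (by simpa using mul_nonneg (radius_nonneg L N) h.pos.le)

/-- The model error is evaluated at the state x of the true system, which lies in S; y only has to
be in Ω. -/
theorem norm_step_le (h : IsSurrogate f g U S Ω η γ L N) {x y : E n} {u : E m} (hx : x ∈ S)
    (hy : y ∈ Ω) (hu : u ∈ U) : ‖g y u - f x u‖ ≤ L * ‖y - x‖ + ‖f x u - g x u‖ := by
  have h1 := h.lipschitz u hu y hy x (h.subset hx)
  have h2 := norm_sub_le_norm_sub_add_norm_sub (g y u) (g x u) (f x u)
  rw [norm_sub_rev (g x u) (f x u)] at h2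
  linarith

theorem norm_traj_sub_le (h : IsSurrogate f g U S Ω η γ L N) {x y : E n} {u : ℕ → E m}
    (hu : u ∈ admissible U ⊤) (hx : ∀ i, traj f u x i ∈ S) (hy : ‖y - x‖ ≤ η) :
    ∀ k < N, ‖traj g u y k - traj f u x k‖ ≤ radius L (k + 1) * η := by
  intro k
  induction k with
  | zero =>
    intro _
    simpa [traj, radius] using hy
  | succ k ih =>
    intro hk
    have h1 := ih (by omega)
    have h2 : traj g u y k ∈ Ω := h.incl _ (hx k) _
      (h1.trans (mul_le_mul_of_nonneg_right (radius_mono L (by omega)) h.pos.le))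
    have hU := mem_of_admissible_top hu k
    have h3 := h.norm_step_le (hx k) h2 hU
    have h4 := h.uniform _ (h.subset (hx k)) _ hU
    have h5 := mul_le_mul_of_nonneg_left h1 L.coe_nonneg
    rw [radius_succ, traj, traj]
    linarith

theorem traj_mem (h : IsSurrogate f g U S Ω η γ L N) {x y : E n} {u : ℕ → E m}
    (hu : u ∈ admissible U ⊤) (hx : ∀ i, traj f u x i ∈ S) (hy : ‖y - x‖ ≤ η) {k : ℕ}
    (hk : k < N) : traj g u y k ∈ Ω :=
  h.incl _ (hx k) _ ((h.norm_traj_sub_le hu hx hy k hk).trans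
    (mul_le_mul_of_nonneg_right (radius_mono L (by omega)) h.pos.le))

end IsSurrogate

/-- Along controls that keep `f` in `S`, the costs of sufficiently accurate surrogates exceed those
of `f` at most by a factor close to one, up to the initial error. -/
theorem exists_costJ_surrogate_le (hQ : Q.PosDef) (hR : R.PosDef) (L : NNReal) (N : ℕ) {δ : ℝ}
    (hδ : 0 < δ) :
    ∃ K > 0, ∃ γ₀ > 0, ∀ (f g : E n → E m → E n) (U : Set (E m)) (S Ω : Set (E n)) (η γ : ℝ),
      0 ≤ γ → γ ≤ γ₀ → IsSurrogate f g U S Ω η γ L N →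
      ∀ x, ∀ u ∈ admissible U ⊤, (∀ i, traj f u x i ∈ S) → ∀ y, ‖y - x‖ ≤ η → ∀ k ≤ N,
        costJ g Q R k y u ≤ (1 + δ) * costJ f Q R k x u + K * ‖y - x‖ ^ 2 := by
  obtain ⟨C, hC, hCle⟩ := exists_le_mul_norm_sq Q
  obtain ⟨A, hA, hAle⟩ := exists_norm_add_norm_sq_le hQ hR
  set D := ∑ i ∈ Finset.range N, errConst L A i with hD
  have hD0 : 0 ≤ D := Finset.sum_nonneg fun i _ => errConst_nonneg _ hA.le i
  set s := δ / 2 with hs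
  have hs0 : 0 < s := by positivity
  set K := N * ((1 + 1 / s) * C * D) + 1 with hK
  have hK0 : 0 < K := by positivity
  -- The bound γ ≤ 1 gives γ² ≤ γ, so γ ≤ s / K suffices for Kγ² ≤ s. Half of δ pays for Young's
  -- inequality, half for the model error.
  refine ⟨K, hK0, min 1 (s / K), by positivity, ?_⟩
  intro f g U S Ω η γ hγ hγle h x u hu hx y hy k hk
  set J := costJ f Q R k x u with hJ
  have hJ0 : 0 ≤ J := costJ_nonneg hQ hR f k x u
  set e := ‖y - x‖ with he
  have herr : ∀ i < k, ‖traj g u y i - traj f u x i‖ ^ 2 ≤ D * (e ^ 2 + γ ^ 2 * J) := by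
    intro i hi
    have h1 := sq_le_errConst (L := L) (C := A) (γ := γ)
      (e := fun i => ‖traj g u y i - traj f u x i‖) (a := fun i => ‖traj f u x i‖ + ‖u i‖)
      (s := fun i => stageCost Q R (traj f u x i) (u i)) hA.le (fun _ => norm_nonneg _)
      (fun _ => stageCost_nonneg hQ hR _ _) (fun _ => hAle _ _) i (by
        intro l hl
        have hU := mem_of_admissible_top hu l
        have h1 := h.norm_step_le (hx l) (h.traj_mem hu hx hy (k := l) (by omega)) hU
        have h2 := h.proportional _ (h.subset (hx l)) _ hU
        simp only [traj]
        linarith)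
    refine h1.trans (mul_le_mul ?_ ?_ ?_ hD0)
    · exact Finset.single_le_sum (f := errConst L A) (fun i _ => errConst_nonneg _ hA.le i)
        (Finset.mem_range.2 (by omega))
    · have := mul_le_mul_of_nonneg_left (costJ_mono hQ hR f hi.le x u) (sq_nonneg γ)
      simp only [costJ] at this
      simp only [hJ, costJ, traj, he]
      linarith
    · have := mul_nonneg (sq_nonneg γ) (costJ_nonneg hQ hR f i x u)
      simp only [costJ] at this
      positivity
  have hsum : costJ g Q R k y u ≤
      (1 + s) * J + k * ((1 + 1 / s) * C * (D * (e ^ 2 + γ ^ 2 * J))) := by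
    have : costJ g Q R k y u ≤ ∑ i ∈ Finset.range k, ((1 + s) * stageCost Q R (traj f u x i) (u i)
        + (1 + 1 / s) * C * (D * (e ^ 2 + γ ^ 2 * J))) :=
      Finset.sum_le_sum fun i hi =>
        stageCost_le_of_sub hQ hs0 hCle hC.le (u i) hR (herr i (Finset.mem_range.1 hi))
    rw [Finset.sum_add_distrib, ← Finset.mul_sum, Finset.sum_const, Finset.card_range,
      nsmul_eq_mul] at this
    exact this
  have hkN : (k : ℝ) ≤ N := by exact_mod_cast hk
  have hG : 0 ≤ e ^ 2 + γ ^ 2 * J := by positivity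
  have h1 : k * ((1 + 1 / s) * C * (D * (e ^ 2 + γ ^ 2 * J))) ≤ K * (e ^ 2 + γ ^ 2 * J) := by
    have h2 : k * ((1 + 1 / s) * C * (D * (e ^ 2 + γ ^ 2 * J))) =
        (k * ((1 + 1 / s) * C * D)) * (e ^ 2 + γ ^ 2 * J) := by ring
    rw [h2]
    refine mul_le_mul_of_nonneg_right ?_ hG
    have := mul_le_mul_of_nonneg_right hkN (show 0 ≤ (1 + 1 / s) * C * D by positivity)
    linarith
  have h3 : K * γ ^ 2 ≤ s := by
    have h4 : γ ≤ 1 := hγle.trans (min_le_left _ _)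
    have h5 : γ ≤ s / K := hγle.trans (min_le_right _ _)
    rw [le_div_iff₀ hK0] at h5
    nlinarith
  have h6 := mul_le_mul_of_nonneg_right h3 hJ0
  have h7 : s + s = δ := by rw [hs]; ring
  nlinarith

/-- A trajectory that starts near an optimal prediction inside `Ω` stays near it. -/
theorem IsSurrogate.norm_traj_sub_traj_le {f g : E n → E m → E n} {U : Set (E m)}
    {S Ω : Set (E n)} {η γ : ℝ} {L : NNReal} {N : ℕ} (h : IsSurrogate f g U S Ω η γ L N)
    {x z : E n} {u : ℕ → E m} {M : ℕ} (hMN : M ≤ N) (hu : ∀ i, i + 1 < M → u i ∈ U)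
    (hball : ∀ i, i + 1 < M → Metric.closedBall (traj g u x i) (radius L N * η) ⊆ Ω)
    (hz : ‖z - x‖ ≤ η) :
    ∀ k < M, ‖traj g u z k - traj g u x k‖ ≤ L ^ k * ‖z - x‖ := by
  intro k
  induction k with
  | zero => intro _; simp [traj]
  | succ k ih =>
    intro hk
    have h1 := ih (by omega)
    have hr : 0 ≤ radius L N * η := mul_nonneg (radius_nonneg L N) h.pos.le
    have h2 : traj g u z k ∈ Ω := by
      refine hball k hk ?_
      rw [Metric.mem_closedBall, dist_eq_norm]
      exact h1.trans (mul_le_mul (pow_le_radius L (by omega)) hz (norm_nonneg _)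
        (radius_nonneg L N))
    have h3 := h.lipschitz _ (hu k hk) _ h2 _ (hball k hk (Metric.mem_closedBall_self hr))
    have h4 := mul_le_mul_of_nonneg_left h1 L.coe_nonneg
    rw [traj, traj, pow_succ]
    linarith

/-- Stage costs along an optimal prediction, when restarted from the true successor state. -/
theorem exists_stageCost_successor_le (hQ : Q.PosDef) (hR : R.PosDef) (L : NNReal) (N : ℕ) {δ : ℝ}
    (hδ : 0 < δ) :
    ∃ γ₀ > 0, ∀ (f g : E n → E m → E n) (U : Set (E m)) (S Ω : Set (E n)) (η γ : ℝ),
      0 ≤ γ → γ ≤ γ₀ → IsSurrogate f g U S Ω η γ L N →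
      ∀ x ∈ S, ∀ u ∈ admissible U (N : ℕ∞),
        (∀ k, k + 1 < N → Metric.closedBall (traj g u x k) (radius L N * η) ⊆ Ω) →
        ∀ k, k + 1 < N → stageCost Q R (traj g (fun i => u (i + 1)) (f x (u 0)) k) (u (k + 1)) ≤
          (1 + δ) * stageCost Q R (traj g u x (k + 1)) (u (k + 1)) +
            δ * stageCost Q R x (u 0) := by
  obtain ⟨C, hC, hCle⟩ := exists_le_mul_norm_sq Q
  obtain ⟨A, hA, hAle⟩ := exists_norm_add_norm_sq_le hQ hR
  set K := (1 + 1 / δ) * C * (radius L N) ^ 2 * A + 1 with hK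
  have hK0 : 0 < K := by positivity
  refine ⟨min 1 (δ / K), by positivity, ?_⟩
  intro f g U S Ω η γ hγ hγle h x hx u hu hball k hk
  have hU : ∀ i < N, u i ∈ U := fun i hi => hu i (by exact_mod_cast hi)
  have htraj : ∀ i, traj g (fun i => u (i + 1)) (g x (u 0)) i = traj g u x (i + 1) := by
    intro i
    induction i with
    | zero => rfl
    | succ i ih => rw [traj, ih]; rfl
  have hz := h.uniform x (h.subset hx) (u 0) (hU 0 (by omega))
  have hz' := h.proportional x (h.subset hx) (u 0) (hU 0 (by omega))
  -- The shifted sequence has only N - 1 prescribed entries, hence the horizon N - 1.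
  have h1 := h.norm_traj_sub_traj_le (M := N - 1) (by omega) (u := fun i => u (i + 1))
    (fun i hi => hU (i + 1) (by omega))
    (fun i hi => by rw [htraj]; exact hball (i + 1) (by omega)) hz k (by omega)
  rw [htraj] at h1
  set ℓ₀ := stageCost Q R x (u 0)
  have hℓ0 : 0 ≤ ℓ₀ := stageCost_nonneg hQ hR _ _
  have h2 : ‖traj g (fun i => u (i + 1)) (f x (u 0)) k - traj g u x (k + 1)‖ ^ 2 ≤
      radius L N ^ 2 * (γ ^ 2 * (A * ℓ₀)) := by
    have h3 := h1.trans (mul_le_mul (pow_le_radius L (by omega : k < N)) hz' (norm_nonneg _)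
        (radius_nonneg L N))
    have h4 := pow_le_pow_left₀ (norm_nonneg _) h3 2
    rw [mul_pow, mul_pow] at h4
    exact h4.trans (by gcongr; exact hAle x (u 0))
  refine (stageCost_le_of_sub hQ hδ hCle hC.le (u (k + 1)) hR h2).trans ?_
  have h3 : K * γ ^ 2 ≤ δ := by
    have h4 : γ ≤ 1 := hγle.trans (min_le_left _ _)
    have h5 : γ ≤ δ / K := hγle.trans (min_le_right _ _)
    rw [le_div_iff₀ hK0] at h5
    nlinarith
  have h4 := mul_le_mul_of_nonneg_right h3 hℓ0
  have h5 : (1 + 1 / δ) * C * (radius L N ^ 2 * (γ ^ 2 * (A * ℓ₀))) = (K - 1) * γ ^ 2 * ℓ₀ := by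
    rw [hK]; ring
  have h6 : 0 ≤ γ ^ 2 * ℓ₀ := by positivity
  rw [h5]
  nlinarith

/-! ### Decrease of the surrogate value along the true closed loop -/

theorem perturbed_tail_le {δ t b a M : ℝ} (hδ0 : 0 ≤ δ) (hδ1 : δ ≤ 1) (ha : 0 ≤ a) (ht1 : 1 ≤ t)
    (htM : t ≤ M) (hb : 0 ≤ b) (hbM : b ≤ 2 * M * a) :
    (1 + δ) * t * ((1 + δ) * b + δ * a) ≤ t * b + δ * (6 * M ^ 2 + 2 * M) * a := by
  have e1 : t * b ≤ M * (2 * M * a) := mul_le_mul htM hbM hb (by linarith)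
  have e2 : δ * (t * b) ≤ δ * (M * (2 * M * a)) := mul_le_mul_of_nonneg_left e1 hδ0
  have e3 : δ * (δ * (t * b)) ≤ 1 * (δ * (t * b)) :=
    mul_le_mul_of_nonneg_right hδ1 (by positivity)
  have e4 : δ * (t * a) ≤ δ * (M * a) := by gcongr
  have e5 : δ * (δ * (t * a)) ≤ 1 * (δ * (t * a)) :=
    mul_le_mul_of_nonneg_right hδ1 (by positivity)
  linarith

/-- The quantitative core of the decrease condition: `lam i` are the stage costs of an optimal
prediction, `ν` is the optimal value at the true successor state. For every prediction time,
either a tail of the prediction can be replaced, or the prediction has reached the boundary of the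
sublevel set. -/
theorem value_le_of_alternatives {T lam : ℕ → ℝ} {N : ℕ} {ν V c δ M ζ : ℝ} (hN : 2 ≤ N)
    (hT : ∀ i, 2 ≤ i → i ≤ N → 1 ≤ T i) (hTM : ∀ i, 2 ≤ i → i ≤ N → T i ≤ M)
    (hY : ∀ i, 1 ≤ i → i ≤ N → T N * decay T i N ≤ T i)
    (hζ : T N * decay T 1 N ≤ 1 - ζ) (hζ0 : 0 < ζ) (hlam : ∀ i, 0 ≤ lam i) (h0 : 0 < lam 0)
    (hV : V = ∑ i ∈ Finset.range N, lam i) (hVc : V ≤ c) (hVle : V ≤ (1 + δ) * T N * lam 0)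
    (hδ0 : 0 < δ) (hδ1 : δ ≤ 1) (hδ : δ * (6 * M ^ 2 + 4 * M + N) ≤ ζ / 4)
    (halt : ∀ i, i + 1 < N →
      ν ≤ ∑ l ∈ Finset.range i, ((1 + δ) * lam (l + 1) + δ * lam 0) +
          (1 + δ) * T (N - i) * ((1 + δ) * lam (i + 1) + δ * lam 0) ∨
        c ≤ (1 + δ) * T N * ((1 + δ) * lam (i + 1) + δ * lam 0)) :
    ν ≤ V - ζ / 4 * lam 0 := by
  by_contra! hcon
  -- Error budget in units of δ λ_0: 6M² + 2M for the perturbed tail, 2M for the factor 1 + δ on the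
  -- partial sum, N for its additive terms.
  set G := 6 * M ^ 2 + 4 * M + N with hG
  set a := lam 0 with ha
  have hM1 : 1 ≤ M := (hT N hN le_rfl).trans (hTM N hN le_rfl)
  have hTN := hT N hN le_rfl
  have hTNM := hTM N hN le_rfl
  have hV2 : V ≤ 2 * M * a := by
    refine hVle.trans (mul_le_mul_of_nonneg_right ?_ h0.le)
    exact mul_le_mul (by linarith) hTNM (by linarith) zero_le_two
  have hsplit : V = a + ∑ l ∈ Finset.range (N - 1), lam (l + 1) := by
    rw [hV, ha]
    obtain ⟨k, rfl⟩ := Nat.exists_eq_add_of_le' (show 1 ≤ N by omega)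
    rw [Finset.sum_range_succ', Nat.add_sub_cancel, add_comm]
  have hpart : ∀ i, i ≤ N - 1 → ∑ l ∈ Finset.range i, lam (l + 1) ≤ V - a := by
    intro i hi
    rw [hsplit, add_sub_cancel_left]
    exact Finset.sum_le_sum_of_subset_of_nonneg (Finset.range_subset_range.2 hi)
      fun _ _ _ => hlam _
  have hlamV : ∀ i, i + 1 < N → lam (i + 1) ≤ V := fun i hi => by
    rw [hV]
    exact Finset.single_le_sum (fun j _ => hlam j) (Finset.mem_range.2 hi)
  have hNR : (0 : ℝ) ≤ N := Nat.cast_nonneg N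
  have hGζ : δ * G * a ≤ ζ / 4 * a := mul_le_mul_of_nonneg_right hδ h0.le
  have htail : ∀ t b, 1 ≤ t → t ≤ M → 0 ≤ b → b ≤ V →
      (1 + δ) * t * ((1 + δ) * b + δ * a) ≤ t * b + δ * (6 * M ^ 2 + 2 * M) * a :=
    fun t b ht1 htM hb hbV => perturbed_tail_le hδ0.le hδ1 h0.le ht1 htM hb (hbV.trans hV2)
  -- A lower bound for ν after all perturbations are paid for, so that the alternatives become the
  -- unperturbed hypotheses of the gap lemma.
  set κ := V - (ζ / 4 + δ * G) * a with hκ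
  have hTd : 0 ≤ T N * decay T 1 N :=
    mul_nonneg (by linarith) (decay_nonneg fun i hi hiN => hT i (by omega) hiN)
  have hVa : a ≤ V := by
    rw [hV]
    exact Finset.single_le_sum (fun j _ => hlam j) (Finset.mem_range.2 (by omega))
  have hκ0 : 0 ≤ κ := by
    rw [hκ]
    have : ζ * a ≤ 1 * a := mul_le_mul_of_nonneg_right (by linarith) h0.le
    linarith
  have key := sub_sum_le_mul_decay (T := T) (c := fun i => lam (i + 1)) (N := N) hκ0 (N - 1)
    (by omega) (fun i hi hiN => hT i (by omega) hiN) (by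
      intro i hi
      have hb := hlamV i (by omega)
      rcases halt i (by omega) with h | h
      · left
        have h1 := htail (T (N - i)) (lam (i + 1)) (hT _ (by omega) (by omega))
          (hTM _ (by omega) (by omega)) (hlam _) hb
        have h2 : ∑ l ∈ Finset.range i, ((1 + δ) * lam (l + 1) + δ * a) =
            (1 + δ) * ∑ l ∈ Finset.range i, lam (l + 1) + i * (δ * a) := by
          rw [Finset.sum_add_distrib, ← Finset.mul_sum, Finset.sum_const, Finset.card_range,
            nsmul_eq_mul]
        rw [h2] at h
        have h3 := mul_le_mul_of_nonneg_left ((hpart i (by omega)).trans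
          (show V - a ≤ 2 * M * a by linarith)) hδ0.le
        have hiN : (i : ℝ) ≤ N := by exact_mod_cast (by omega : i ≤ N)
        have h4 : (i : ℝ) * (δ * a) ≤ N * (δ * a) :=
          mul_le_mul_of_nonneg_right hiN (by positivity)
        rw [hκ, hG]
        have h5 := mul_nonneg hζ0.le h0.le
        linarith
      · right
        refine ⟨hY _ (by omega) (by omega), ?_⟩
        have h1 := htail (T N) (lam (i + 1)) hTN hTNM (hlam _) hb
        have h2 : 0 ≤ δ * (2 * M + N) * a := by positivity
        have h3 : 0 ≤ ζ / 4 * a := by positivity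
        rw [hκ, hG]
        linarith)
  have he : N - (N - 1) = 1 := by omega
  rw [he] at key
  have hd0 : 0 ≤ decay T 1 N := decay_nonneg fun i hi hiN => hT i (by omega) hiN
  have h1 : κ * decay T 1 N ≤ ((1 + δ) * T N * a) * decay T 1 N := by
    refine mul_le_mul_of_nonneg_right (le_trans ?_ hVle) hd0
    rw [hκ]
    have : 0 ≤ (ζ / 4 + δ * G) * a := by positivity
    linarith
  have h2 : ((1 + δ) * T N * a) * decay T 1 N ≤ ((1 - ζ) + δ) * a := by
    have : ((1 + δ) * T N * a) * decay T 1 N = (1 + δ) * (T N * decay T 1 N) * a := by ring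
    rw [this]
    refine mul_le_mul_of_nonneg_right ?_ h0.le
    have := mul_le_mul_of_nonneg_left (show T N * decay T 1 N ≤ 1 by linarith) hδ0.le
    linarith
  -- With δ ≤ δG ≤ ζ/4, the gap estimate would give (1 - ζ/2) λ_0 ≤ (1 - 3ζ/4) λ_0.
  have h3 : δ ≤ δ * G := by
    have : 1 ≤ G := by rw [hG]; nlinarith
    nlinarith
  have h4 : 0 < ζ * a := by positivity
  have h5 := mul_le_mul_of_nonneg_right h3 h0.le
  have h6 : κ = a + ∑ l ∈ Finset.range (N - 1), lam (l + 1) - (ζ / 4 + δ * G) * a := by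
    rw [hκ, ← hsplit]
  linarith

/-- If the value function of `g` near every point of `S` is bounded by `T ℓ⋆`, up to a quadratic
error, then a sublevel set contained in `S` contains the ellipsoid on which this bound is below the
level. -/
theorem mem_sublevel_of_lt (hQ : Q.PosDef) {g : E n → E m → E n} {U : Set (E m)}
    {S : Set (E n)} {N : ℕ} {T K η c : ℝ} (h0 : (0 : E n) ∈ S) (hT : 0 ≤ T) (hK : 0 < K)
    (hη : 0 < η) (hval : ∀ x ∈ S, ∀ y, ‖y - x‖ ≤ η →
      valueV g U Q R N y ≤ T * weightedSq Q x + K * ‖y - x‖ ^ 2)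
    (hsub : sublevel g U Q R N c ⊆ S) {x : E n} (hx : T * weightedSq Q x < c) : x ∈ S := by
  set gap := c - T * weightedSq Q x with hgap
  have hgap0 : 0 < gap := by linarith
  -- A step length d ≤ 1 with Kd ≤ gap keeps the quadratic error Kd² below the gap.
  set d := min η (min 1 (gap / K)) with hd
  have hd0 : 0 < d := by positivity
  have hdη : d ≤ η := min_le_left _ _
  have hd1 : d ≤ 1 := (min_le_right _ _).trans (min_le_left _ _)
  have hdK : d * K ≤ gap := by
    rw [← le_div_iff₀ hK]; exact (min_le_right _ _).trans (min_le_right _ _)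
  obtain ⟨p, hp⟩ := exists_nat_gt (‖x‖ / d)
  have hp0 : (0 : ℝ) < p := lt_of_le_of_lt (by positivity) hp
  have hstep : ‖x‖ / p ≤ d := by
    rw [div_lt_iff₀ hd0] at hp
    rw [div_le_iff₀ hp0]
    linarith
  -- Walk from the origin to x in steps of length at most d: the value bound at a point of S puts
  -- the next point into the sublevel set, hence into S. Neither connectedness nor star-shapedness
  -- of S is needed.
  have key : ∀ i : ℕ, i ≤ p → ((i : ℝ) / p) • x ∈ S := by
    intro i
    induction i with
    | zero => intro _; simpa using h0
    | succ i ih =>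
      intro hi
      have hi' := ih (by omega)
      have hdist : ‖(((i + 1 : ℕ) : ℝ) / p) • x - ((i : ℝ) / p) • x‖ = ‖x‖ / p := by
        rw [← sub_smul, Nat.cast_add, Nat.cast_one, add_div, add_sub_cancel_left, norm_smul,
          Real.norm_of_nonneg (by positivity)]
        ring
      have h1 := hval _ hi' _ (hdist.trans_le (hstep.trans hdη))
      rw [hdist, weightedSq_smul] at h1
      have hip : (i : ℝ) / p ≤ 1 := by
        rw [div_le_one hp0]; exact_mod_cast (by omega : i ≤ p)
      have h2 : ((i : ℝ) / p) ^ 2 ≤ 1 := pow_le_one₀ (by positivity) hip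
      have h3 : T * (((i : ℝ) / p) ^ 2 * weightedSq Q x) ≤ T * weightedSq Q x :=
        mul_le_mul_of_nonneg_left
          (mul_le_of_le_one_left (weightedSq_nonneg hQ x) h2) hT
      have h4 : (‖x‖ / p) ^ 2 ≤ d := by
        have : 0 ≤ ‖x‖ / p := by positivity
        nlinarith
      exact hsub (show valueV g U Q R N _ ≤ c by nlinarith)
  have := key p le_rfl
  rwa [div_self hp0.ne', one_smul] at this

/-- The optimal value of the surrogate decreases along the true closed loop. -/
theorem valueV_successor_le (hQ : Q.PosDef) (hR : R.PosDef) {f g : E n → E m → E n}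
    {U : Set (E m)} {S : Set (E n)} {T : ℕ → ℝ} {N : ℕ} {c δ M ζ K η : ℝ} (hN : 2 ≤ N)
    (h0S : (0 : E n) ∈ S)
    (hT : ∀ i, 2 ≤ i → i ≤ N → 1 ≤ T i) (hTM : ∀ i, 2 ≤ i → i ≤ N → T i ≤ M)
    (hY : ∀ i, 1 ≤ i → i ≤ N → T N * decay T i N ≤ T i)
    (hζ : T N * decay T 1 N ≤ 1 - ζ) (hζ0 : 0 < ζ)
    (hδ0 : 0 < δ) (hδ1 : δ ≤ 1) (hδ : δ * (6 * M ^ 2 + 4 * M + N) ≤ ζ / 4)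
    (hK : 0 < K) (hη : 0 < η)
    (hcost : ∀ k, 2 ≤ k → k ≤ N → ∀ x ∈ S, ∃ v ∈ admissible U ⊤, ∀ y, ‖y - x‖ ≤ η →
      costJ g Q R k y v ≤ (1 + δ) * T k * weightedSq Q x + K * ‖y - x‖ ^ 2)
    (hsub : sublevel g U Q R N c ⊆ S) {x : E n} (hx : x ∈ sublevel g U Q R N c) {u : ℕ → E m}
    (hu : IsOptimal g U Q R N x u)
    (hsucc : ∀ k, k + 1 < N →
      stageCost Q R (traj g (fun i => u (i + 1)) (f x (u 0)) k) (u (k + 1)) ≤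
        (1 + δ) * stageCost Q R (traj g u x (k + 1)) (u (k + 1)) + δ * stageCost Q R x (u 0)) :
    valueV g U Q R N (f x (u 0)) ≤ valueV g U Q R N x - ζ / 4 * stageCost Q R x (u 0) := by
  set z := f x (u 0) with hz
  set lam : ℕ → ℝ := fun i => stageCost Q R (traj g u x i) (u i) with hlam
  have hlam0 : ∀ i, 0 ≤ lam i := fun i => stageCost_nonneg hQ hR _ _
  have hV : valueV g U Q R N x = ∑ i ∈ Finset.range N, lam i := hu.costJ_eq
  have hcost' : ∀ k, 2 ≤ k → k ≤ N → ∀ x ∈ S, ∃ v ∈ admissible U ⊤,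
      costJ g Q R k x v ≤ (1 + δ) * T k * weightedSq Q x := by
    intro k hk hkN x hx
    obtain ⟨v, hv, hle⟩ := hcost k hk hkN x hx
    refine ⟨v, hv, ?_⟩
    simpa using hle x (by simpa using hη.le)
  have hTN := hT N hN le_rfl
  have hVle : valueV g U Q R N x ≤ (1 + δ) * T N * lam 0 := by
    obtain ⟨v, hv, hle⟩ := hcost' N hN le_rfl x (hsub hx)
    refine (valueV_le hQ hR (admissible_of_top hv N)).trans (hle.trans ?_)
    exact mul_le_mul_of_nonneg_left (weightedSq_le_stageCost hR x (u 0)) (by positivity)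
  have hU : ∀ i < N, u i ∈ U := fun i hi => hu.1 i (by exact_mod_cast hi)
  have hlam00 : lam 0 = stageCost Q R x (u 0) := rfl
  rw [← hlam00]
  rcases (hlam0 0).eq_or_lt with h0 | h0
  -- Zero first stage cost forces zero optimal value; then the true successor is the origin, whose
  -- value is at most zero.
  · have h1 : lam 1 ≤ 0 := by
      have h2 : lam 1 ≤ ∑ i ∈ Finset.range N, lam i :=
        Finset.single_le_sum (fun j _ => hlam0 j) (Finset.mem_range.2 (by omega))
      rw [← h0, mul_zero] at hVle
      linarith
    have h2 : weightedSq Q z ≤ 0 := by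
      have h3 := hsucc 0 (by omega)
      have h4 := weightedSq_le_stageCost (Q := Q) hR z (u 1)
      have h5 : stageCost Q R z (u 1) ≤ (1 + δ) * lam 1 + δ * lam 0 := h3
      have h6 : (1 + δ) * lam 1 ≤ 0 := mul_nonpos_of_nonneg_of_nonpos (by linarith) h1
      rw [← h0] at h5
      linarith
    have hz0 : z = 0 := by
      by_contra hne
      exact absurd (weightedSq_pos hQ hne) (not_lt.2 h2)
    obtain ⟨v, hv, hle⟩ := hcost' N hN le_rfl 0 h0S
    rw [weightedSq_zero, mul_zero] at hle
    rw [← h0, hz0, mul_zero, sub_zero, hV]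
    exact ((valueV_le hQ hR (admissible_of_top hv N)).trans hle).trans
      (Finset.sum_nonneg fun i _ => hlam0 i)
  · refine value_le_of_alternatives hN hT hTM hY hζ hζ0 hlam0 h0 hV hx hVle hδ0 hδ1 hδ ?_
    intro i hi
    have hst : weightedSq Q (traj g (fun i => u (i + 1)) z i) ≤
        (1 + δ) * lam (i + 1) + δ * lam 0 :=
      (weightedSq_le_stageCost hR _ (u (i + 1))).trans (hsucc i hi)
    by_cases hS : traj g (fun i => u (i + 1)) z i ∈ S
    · left
      obtain ⟨v, hv, hle⟩ := hcost' (N - i) (by omega) (by omega) _ hS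
      have h1 := valueV_le (Q := Q) (R := R) (g := g) (x := z) hQ hR
        (concat_mem_admissible (U := U) (i := i) (N := N) (u := fun i => u (i + 1)) (v := v)
          (fun k hk => hU (k + 1) (by omega)) fun k _ => mem_of_admissible_top hv k)
      have h2 := costJ_concat (Q := Q) (R := R) g i (N - i) z (fun i => u (i + 1)) v
      rw [Nat.add_sub_cancel' (by omega)] at h2
      rw [h2] at h1
      refine h1.trans (add_le_add (Finset.sum_le_sum fun l hl => ?_) (hle.trans ?_))
      · exact hsucc l (by have := Finset.mem_range.1 hl; omega)
      · have := hT (N - i) (by omega) (by omega)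
        exact mul_le_mul_of_nonneg_left hst (by positivity)
    · right
      -- A state outside S cannot lie in the ellipsoid contained in the sublevel set.
      by_contra! hlt
      refine hS (mem_sublevel_of_lt (Q := Q) (R := R) (T := (1 + δ) * T N) hQ h0S (by positivity)
        hK hη ?_ hsub
        (lt_of_le_of_lt (mul_le_mul_of_nonneg_left hst (by positivity)) hlt))
      intro x hx y hy
      obtain ⟨v, hv, hle⟩ := hcost N hN le_rfl x hx
      exact (valueV_le hQ hR (admissible_of_top hv N)).trans (hle y hy)

/-! ### From quadratic decrease to a comparison function -/

/-- A value function with quadratic bounds that decreases by a multiple of `‖x‖²` yields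
asymptotic stability. -/
theorem asymptoticallyStableOn_of_value {F : E n → E n} {V : E n → ℝ} {Y : Set (E n)}
    (hY : Y ∈ 𝓝 (0 : E n)) (hmap : MapsTo F Y Y) {q M a : ℝ} (hq : 0 < q) (hM : 0 < M)
    (ha : 0 < a) (hlow : ∀ x ∈ Y, q * ‖x‖ ^ 2 ≤ V x) (hup : ∀ x ∈ Y, V x ≤ M * ‖x‖ ^ 2)
    (hdec : ∀ x ∈ Y, V (F x) ≤ V x - a * ‖x‖ ^ 2) : AsymptoticallyStableOn F Y := by
  refine ⟨hY, hmap, ?_⟩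
  -- The floor 1/2 keeps θ positive, so the comparison function stays strictly increasing in r.
  set θ := max (1 - a / M) (1 / 2) with hθ
  have hθ0 : 0 < θ := lt_of_lt_of_le (by norm_num) (le_max_right _ _)
  have hθ1 : θ < 1 := max_lt (by have : 0 < a / M := by positivity
                                 linarith) (by norm_num)
  have hstep : ∀ x ∈ Y, V (F x) ≤ θ * V x := by
    intro x hx
    have h1 : a / M * V x ≤ a * ‖x‖ ^ 2 := by
      rw [div_mul_eq_mul_div, div_le_iff₀ hM]
      nlinarith [hup x hx]
    have hV0 : 0 ≤ V x := le_trans (by positivity) (hlow x hx)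
    have h2 := mul_le_mul_of_nonneg_right (le_max_left (1 - a / M) (1 / 2)) hV0
    rw [← hθ] at h2
    linarith [hdec x hx]
  have hiter : ∀ x ∈ Y, ∀ k, F^[k] x ∈ Y ∧ V (F^[k] x) ≤ θ ^ k * V x := by
    intro x hx k
    induction k with
    | zero => simpa using hx
    | succ k ih =>
      rw [Function.iterate_succ_apply']
      refine ⟨hmap ih.1, (hstep _ ih.1).trans ?_⟩
      rw [pow_succ']
      nlinarith [ih.2]
  set s := √θ with hs
  have hs0 : 0 < s := Real.sqrt_pos.2 hθ0
  have hs1 : s < 1 := by rw [hs, Real.sqrt_lt' one_pos]; simpa using hθ1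
  set D := √(M / q) with hD
  have hD0 : 0 < D := Real.sqrt_pos.2 (by positivity)
  refine ⟨fun r k => D * s ^ k * r, ⟨fun k => ⟨by fun_prop, ?_, by simp⟩, ?_, ?_⟩, ?_⟩
  · intro r _ t _ hrt
    exact mul_lt_mul_of_pos_left hrt (by positivity)
  · intro r hr i j hij
    have := pow_le_pow_of_le_one hs0.le hs1.le hij
    simp only
    gcongr
  · intro r _
    have h1 := ((tendsto_pow_atTop_nhds_zero_of_lt_one hs0.le hs1).const_mul D).mul_const r
    simpa using h1
  · intro x hx k
    obtain ⟨h1, h2⟩ := hiter x hx k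
    have h3 : q * ‖F^[k] x‖ ^ 2 ≤ θ ^ k * (M * ‖x‖ ^ 2) :=
      ((hlow _ h1).trans h2).trans (mul_le_mul_of_nonneg_left (hup x hx) (by positivity))
    refine le_of_sq_le_sq ?_ (by positivity)
    have h4 : (D * s ^ k * ‖x‖) ^ 2 = M / q * θ ^ k * ‖x‖ ^ 2 := by
      rw [mul_pow, mul_pow, hD, Real.sq_sqrt (by positivity), ← pow_mul, mul_comm k 2, pow_mul, hs,
        Real.sq_sqrt hθ0.le]
    rw [h4]
    have h5 : M / q * θ ^ k * ‖x‖ ^ 2 = (θ ^ k * (M * ‖x‖ ^ 2)) / q := by ring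
    rw [h5, le_div_iff₀ hq]
    linarith

/-! ### Strict bounds and the data of the theorem -/

/-- Positivity of the suboptimality degree, without denominators. -/
theorem mul_prod_lt_of_alpha_pos {B : ℕ → ℝ} {N : ℕ} (hN : 2 ≤ N) (hB : ∀ j, 2 ≤ j → 1 ≤ B j)
    (hα : 0 < alpha B N) :
    B N * ∏ i ∈ Finset.Icc 2 N, (B i - 1) < ∏ i ∈ Finset.Icc 2 N, B i := by
  have hset : Finset.Icc 2 N = insert 2 (Finset.Icc 3 N) := by
    ext i; simp only [Finset.mem_Icc, Finset.mem_insert]; omega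
  have hge : ∀ i ∈ Finset.Icc 3 N, 1 ≤ B i := fun i hi => hB i (by
    have := (Finset.mem_Icc.1 hi).1
    omega)
  have hpos : 0 < ∏ i ∈ Finset.Icc 3 N, B i :=
    Finset.prod_pos fun i hi => by linarith [hge i hi]
  have hle : ∏ i ∈ Finset.Icc 3 N, (B i - 1) ≤ ∏ i ∈ Finset.Icc 3 N, B i :=
    Finset.prod_le_prod (fun i hi => by linarith [hge i hi]) fun i _ => by linarith
  unfold alpha at hα
  rw [hset, Finset.prod_insert (by simp)] at hα ⊢
  rw [Finset.prod_insert (by simp)]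
  set p := ∏ i ∈ Finset.Icc 3 N, (B i - 1)
  set r := ∏ i ∈ Finset.Icc 3 N, B i
  have h2 := hB 2 le_rfl
  have hden : 0 < B 2 * r - (B 2 - 1) * p := by
    have := mul_le_mul_of_nonneg_left hle (sub_nonneg.2 h2)
    linarith
  have h3 : (B 2 - 1) * (B N - 1) * p / (B 2 * r - (B 2 - 1) * p) < 1 := by linarith
  rw [div_lt_one hden] at h3
  linarith

/-- The suboptimality condition is open, so all bounds can be enlarged slightly; this buys the
strictness needed for attaining the tightened bounds. -/
theorem exists_pos_perturbation {B : ℕ → ℝ} {N : ℕ}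
    (h : B N * ∏ i ∈ Finset.Icc 2 N, (B i - 1) < ∏ i ∈ Finset.Icc 2 N, B i) :
    ∃ τ > 0, (B N + τ) * ∏ i ∈ Finset.Icc 2 N, (B i + τ - 1) <
      ∏ i ∈ Finset.Icc 2 N, (B i + τ) := by
  have h1 : ContinuousAt (fun τ : ℝ => (B N + τ) * ∏ i ∈ Finset.Icc 2 N, (B i + τ - 1)) 0 := by
    fun_prop
  have h2 : ContinuousAt (fun τ : ℝ => ∏ i ∈ Finset.Icc 2 N, (B i + τ)) 0 := by fun_prop
  have h3 := h1.eventually_lt h2 (by simpa using h)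
  obtain ⟨τ, hτ, hτ0⟩ := ((h3.filter_mono nhdsWithin_le_nhds).and
    (self_mem_nhdsWithin (a := (0 : ℝ)) (s := Ioi 0))).exists
  exact ⟨τ, hτ0, hτ⟩

/-- Cost controllability with positive suboptimality degree holds with strict bounds. -/
theorem CostControllable.exists_strict_bounds (hQ : Q.PosDef) (hR : R.PosDef)
    {f : E n → E m → E n} {U : Set (E m)} {S : Set (E n)} {B : ℕ → ℝ} (hU : (0 : E m) ∈ U)
    (hcc : CostControllable f U Q R S B) {N : ℕ} (hN : 2 ≤ N) (hα : 0 < alpha B N) :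
    ∃ B' : ℕ → ℝ, (∀ j, 2 ≤ j → 1 < B' j) ∧
      B' N * ∏ i ∈ Finset.Icc 2 N, (B' i - 1) < ∏ i ∈ Finset.Icc 2 N, B' i ∧
      ∀ x ∈ S, ∃ u ∈ admissible U ⊤, (∀ k, traj f u x k ∈ S) ∧ ∀ k, 2 ≤ k →
        costJ f Q R k x u ≤ B' k * weightedSq Q x ∧
          (0 < weightedSq Q x → costJ f Q R k x u < B' k * weightedSq Q x) := by
  obtain ⟨h0, -, -, hcc⟩ := hcc
  simp only [minStageCost_eq Q R hR U hU] at hcc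
  by_cases hn : ∀ x : E n, x = 0
  -- In the zero-dimensional state space all costs in the hypothesis are bounded by 0 and B is
  -- unconstrained, so any suitable constant serves.
  · refine ⟨fun _ => 3 / 2, fun _ _ => by norm_num, ?_, fun x hx => ?_⟩
    · simp only [Finset.prod_const]
      have h1 : (3 / 2 - 1 : ℝ) ^ (Finset.Icc 2 N).card = (1 / 2) ^ (Finset.Icc 2 N).card := by
        norm_num
      have h2 : (3 / 2 : ℝ) ^ (Finset.Icc 2 N).card =
          3 ^ (Finset.Icc 2 N).card * (1 / 2) ^ (Finset.Icc 2 N).card := by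
        rw [← mul_pow]; norm_num
      rw [h1, h2]
      refine mul_lt_mul_of_pos_right ?_ (by positivity)
      have h3 : (3 : ℝ) ^ 1 ≤ 3 ^ (Finset.Icc 2 N).card :=
        pow_le_pow_right₀ (by norm_num) (by rw [Nat.card_Icc]; omega)
      linarith
    · obtain ⟨u, hu, huS, hucost⟩ := hcc x hx
      refine ⟨u, hu, huS, fun k hk => ?_⟩
      have := (hucost k (by omega)).2
      rw [hn x, weightedSq_zero] at this ⊢
      exact ⟨by linarith, fun h => absurd h (lt_irrefl _)⟩
  · push Not at hn
    obtain ⟨v, hv⟩ := hn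
    have hlim : Tendsto (fun t : ℝ => t • v) (𝓝[>] 0) (𝓝 0) := by
      have : Tendsto (fun t : ℝ => t • v) (𝓝 0) (𝓝 ((0 : ℝ) • v)) :=
        (continuous_id.smul continuous_const).tendsto 0
      rw [zero_smul] at this
      exact this.mono_left nhdsWithin_le_nhds
    -- A nonzero state in S forces B_j ≥ 1, since the first stage alone costs at least ℓ⋆.
    obtain ⟨t, htS, ht0⟩ := ((hlim.eventually (mem_interior_iff_mem_nhds.1 h0)).and
      (self_mem_nhdsWithin (a := (0 : ℝ)) (s := Ioi 0))).exists
    have hw := weightedSq_pos hQ (smul_ne_zero (ne_of_gt ht0) hv)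
    obtain ⟨u, -, -, hucost⟩ := hcc _ htS
    have hB : ∀ j, 2 ≤ j → 1 ≤ B j := by
      intro j hj
      have h1 := (hucost j (by omega)).2
      have h2 := stageCost_le_costJ hQ hR f (show 0 < j by omega) (t • v) u
      have h3 := weightedSq_le_stageCost (Q := Q) hR (t • v) (u 0)
      exact le_of_mul_le_mul_right (by simp only [traj] at h2; linarith) hw
    obtain ⟨τ, hτ, hτ'⟩ := exists_pos_perturbation (mul_prod_lt_of_alpha_pos hN hB hα)
    refine ⟨fun j => B j + τ, fun j hj => by linarith [hB j hj], hτ', fun x hx => ?_⟩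
    obtain ⟨u, hu, huS, hucost⟩ := hcc x hx
    refine ⟨u, hu, huS, fun k hk => ?_⟩
    have h1 := (hucost k (by omega)).2
    have h2 := mul_nonneg hτ.le (weightedSq_nonneg hQ x)
    refine ⟨by linarith, fun h => ?_⟩
    have h3 := mul_pos hτ h
    linarith

theorem isSurrogate_of_errorBounds {f : E n → E m → E n} {fs : ℝ → E n → E m → E n}
    {U : Set (E m)} {S Ω : Set (E n)} {cx cu η : ℝ → ℝ} {L : NNReal} {N : ℕ} {εbar ε : ℝ}
    (herr : ErrorBounds f fs U Ω εbar cx cu η) (hlip : UniformLipschitz fs U Ω εbar L)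
    (hε : ε ∈ Ioc 0 εbar) (hincl : S + Metric.closedBall (0 : E n) (radius L N * η ε) ⊆ Ω) :
    IsSurrogate f (fs ε) U S Ω (η ε) (max (max (cx ε) (cu ε)) (η ε)) L N where
  pos := herr.pos ε hε
  uniform := herr.uniform ε hε
  proportional x hx u hu := by
    refine (herr.proportional ε hε x hx u hu).trans ?_
    rw [mul_add]
    exact add_le_add
      (mul_le_mul_of_nonneg_right ((le_max_left _ _).trans (le_max_left _ _)) (norm_nonneg x))
      (mul_le_mul_of_nonneg_right ((le_max_right _ _).trans (le_max_left _ _)) (norm_nonneg u))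
  lipschitz u hu x hx y hy := by
    obtain ⟨l, hl, hl'⟩ := hlip ε hε
    have h1 := (hl' u hu).dist_le_mul x hx y hy
    rw [dist_eq_norm, dist_eq_norm] at h1
    exact h1.trans (mul_le_mul_of_nonneg_right (by exact_mod_cast hl) (norm_nonneg _))
  incl x hx y hy := hincl ⟨x, hx, y - x, by simpa using hy, by simp⟩

end SurrogateMPC

end

/-! ### Choice of constants and conclusion -/

open SurrogateMPC in
theorem mainTheorem1 {n m : ℕ}
    (f : SurrogateMPC.E n → SurrogateMPC.E m → SurrogateMPC.E n)
    (U : Set (SurrogateMPC.E m))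
    (hsys : SurrogateMPC.StandingSystem f U)
    (Q : Matrix (Fin n) (Fin n) ℝ) (R : Matrix (Fin m) (Fin m) ℝ)
    (hQ : Q.PosDef) (hR : R.PosDef)
    (εbar : ℝ) (hεbar : 0 < εbar)
    (fs : ℝ → SurrogateMPC.E n → SurrogateMPC.E m → SurrogateMPC.E n)
    (Ω S : Set (SurrogateMPC.E n)) (cx cu η : ℝ → ℝ) (Lbar : NNReal)
    (herr : SurrogateMPC.ErrorBounds f fs U Ω εbar cx cu η)
    (hlip : SurrogateMPC.UniformLipschitz fs U Ω εbar Lbar)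
    (B : ℕ → ℝ) (hcc : SurrogateMPC.CostControllable f U Q R S B)
    (N : ℕ) (hN : 2 ≤ N)
    (hincl : ∀ ε ∈ Set.Ioc 0 εbar,
      S + Metric.closedBall (0 : SurrogateMPC.E n) (SurrogateMPC.radius Lbar N * η ε) ⊆ Ω)
    (hα : SurrogateMPC.alpha B N ∈ Set.Ioc (0 : ℝ) 1) :
    ∃ ε₀ ∈ Set.Ioc 0 εbar, ∀ ε ∈ Set.Ioo 0 ε₀, ∀ c : ℝ, 0 < c →
      SurrogateMPC.sublevel (fs ε) U Q R N c ⊆ S →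
      SurrogateMPC.PredictionsInside (fs ε) U Q R N
        (SurrogateMPC.sublevel (fs ε) U Q R N c) (SurrogateMPC.radius Lbar N * η ε) Ω →
      ∀ μ : SurrogateMPC.E n → SurrogateMPC.E m,
        SurrogateMPC.IsMPCFeedbackOn (fs ε) U Q R N
          (SurrogateMPC.sublevel (fs ε) U Q R N c) μ →
        SurrogateMPC.AsymptoticallyStableOn (fun x => f x (μ x))
          (SurrogateMPC.sublevel (fs ε) U Q R N c) := by
  have h0S : (0 : E n) ∈ S := interior_subset hcc.1
  obtain ⟨B', hB, hBα, hBcc⟩ :=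
    hcc.exists_strict_bounds hQ hR (interior_subset hsys.zero_mem) hN hα.1
  set T := tightBound B' with hTdef
  have hT1 : ∀ i, 1 ≤ i → 1 ≤ T i := fun i hi => one_le_tightBound hB hi
  have hP := tightBound_mul_decay_lt_one hB hN hBα
  have hY : ∀ i, 1 ≤ i → i ≤ N → T N * decay T i N ≤ T i :=
    fun i hi hiN => tightBound_mul_decay_le hB hN hP hi hiN
  set ζ := 1 - T N * decay T 1 N with hζ
  have hζ0 : 0 < ζ := by rw [hζ]; linarith
  set M := ∑ i ∈ Finset.Icc 2 N, T i with hM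
  have hTM : ∀ i, 2 ≤ i → i ≤ N → T i ≤ M := fun i hi hiN =>
    Finset.single_le_sum (fun j hj => by
      have := hT1 j (by have := (Finset.mem_Icc.1 hj).1; omega)
      linarith) (Finset.mem_Icc.2 ⟨hi, hiN⟩)
  have hTN := hT1 N (by omega)
  have hM1 : 1 ≤ M := hTN.trans (hTM N hN le_rfl)
  have hG : 0 < 6 * M ^ 2 + 4 * M + N := by positivity
  set δ := min 1 (ζ / 4 / (6 * M ^ 2 + 4 * M + N)) with hδ
  have hδ0 : 0 < δ := by positivity
  have hδ1 : δ ≤ 1 := min_le_left _ _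
  have hδG : δ * (6 * M ^ 2 + 4 * M + N) ≤ ζ / 4 := by
    rw [← le_div_iff₀ hG]; exact min_le_right _ _
  obtain ⟨K, hK, γ₁, hγ₁, hpert⟩ := exists_costJ_surrogate_le hQ hR Lbar N hδ0
  obtain ⟨γ₂, hγ₂, hpred⟩ := exists_stageCost_successor_le hQ hR Lbar N hδ0
  -- The thresholds for γ do not involve the level c or the surrogate, so one ε₀ serves all levels.
  obtain ⟨ε₁, hε₁, hsmall⟩ := mem_nhdsGT_iff_exists_Ioo_subset.1
    (herr.tendsto_zero.eventually (gt_mem_nhds (lt_min hγ₁ hγ₂)))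
  refine ⟨min εbar ε₁, ⟨lt_min hεbar hε₁, min_le_left _ _⟩, ?_⟩
  intro ε hε c hc hsub hinside μ hμ
  have hεI : ε ∈ Ioc 0 εbar := ⟨hε.1, hε.2.le.trans (min_le_left _ _)⟩
  have hs := isSurrogate_of_errorBounds herr hlip hεI (hincl ε hεI)
  have hγ0 : 0 ≤ max (max (cx ε) (cu ε)) (η ε) := hs.pos.le.trans (le_max_right _ _)
  have hγlt := hsmall ⟨hε.1, hε.2.trans_le (min_le_right _ _)⟩
  simp only [mem_ofPred_eq] at hγlt
  have hcost : ∀ k, 2 ≤ k → k ≤ N → ∀ x ∈ S, ∃ v ∈ admissible U ⊤, ∀ y, ‖y - x‖ ≤ η ε →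
      costJ (fs ε) Q R k y v ≤ (1 + δ) * T k * weightedSq Q x + K * ‖y - x‖ ^ 2 := by
    intro k hk hkN x hx
    obtain ⟨v, hv, hvS, hle⟩ := exists_viable_costJ_le hQ hR hB hBcc k hk x hx
    refine ⟨v, hv, fun y hy => ?_⟩
    have h1 := hpert f (fs ε) U S Ω (η ε) _ hγ0 (hγlt.le.trans (min_le_left _ _)) hs x v hv hvS y
      hy k hkN
    have h2 := mul_le_mul_of_nonneg_left hle (show 0 ≤ 1 + δ by linarith)
    linarith
  obtain ⟨q, hq, hqle⟩ := exists_mul_norm_sq_le hQ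
  obtain ⟨C, hC, hCle⟩ := exists_le_mul_norm_sq Q
  have hup : ∀ x ∈ S, valueV (fs ε) U Q R N x ≤ (1 + δ) * T N * C * ‖x‖ ^ 2 := by
    intro x hx
    obtain ⟨v, hv, hle⟩ := hcost N hN le_rfl x hx
    have h1 := hle x (by simpa using hs.pos.le)
    rw [sub_self, norm_zero] at h1
    have h2 := mul_le_mul_of_nonneg_left (hCle x) (show 0 ≤ (1 + δ) * T N by positivity)
    have h3 := valueV_le hQ hR (g := fs ε) (x := x) (admissible_of_top hv N)
    linarith
  have hdec : ∀ x ∈ sublevel (fs ε) U Q R N c, valueV (fs ε) U Q R N (f x (μ x)) ≤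
      valueV (fs ε) U Q R N x - ζ / 4 * q * ‖x‖ ^ 2 := by
    intro x hx
    obtain ⟨u, hu, hμx⟩ := hμ x hx
    rw [hμx]
    have h1 := valueV_successor_le hQ hR (f := f) (g := fs ε) (ζ := ζ) hN h0S
      (fun i hi _ => hT1 i (by omega)) hTM hY (by rw [hζ]; linarith) hζ0 hδ0 hδ1 hδG hK hs.pos
      hcost hsub hx hu
      (hpred f (fs ε) U S Ω (η ε) _ hγ0 (hγlt.le.trans (min_le_right _ _)) hs x (hsub hx) u hu.1
        (hinside x hx u hu))
    have h2 := mul_le_mul_of_nonneg_left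
      ((hqle x).trans (weightedSq_le_stageCost hR x (u 0))) (show 0 ≤ ζ / 4 by positivity)
    linarith
  refine asymptoticallyStableOn_of_value (V := valueV (fs ε) U Q R N) (q := q)
    (M := (1 + δ) * T N * C) (a := ζ / 4 * q) ?_ ?_ hq (by positivity) (by positivity) ?_
    (fun x hx => hup x (hsub hx)) hdec
  -- Controls chosen for x = 0 give the value bound K‖y‖² near the origin, so the sublevel set is a
  -- neighbourhood.
  · obtain ⟨v, hv, hle⟩ := hcost N hN le_rfl 0 h0S
    have h1 : Tendsto (fun y : E n => K * ‖y‖ ^ 2) (𝓝 0) (𝓝 0) := by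
      have : Continuous fun y : E n => K * ‖y‖ ^ 2 := by fun_prop
      simpa using this.tendsto 0
    filter_upwards [Metric.closedBall_mem_nhds (0 : E n) hs.pos,
      h1.eventually (gt_mem_nhds hc)] with y hy hyc
    have h2 := hle y (by simpa using hy)
    rw [weightedSq_zero, mul_zero, zero_add, sub_zero] at h2
    exact ((valueV_le hQ hR (admissible_of_top hv N)).trans h2).trans hyc.le
  · intro x hx
    have h1 : valueV (fs ε) U Q R N x ≤ c := hx
    have h2 : 0 ≤ ζ / 4 * q * ‖x‖ ^ 2 := by positivity
    exact (hdec x hx).trans (by linarith)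
  · intro x hx
    obtain ⟨u, hu, -⟩ := hμ x hx
    rw [hu.costJ_eq]
    exact ((hqle x).trans (weightedSq_le_stageCost hR x (u 0))).trans
      (stageCost_le_costJ hQ hR (fs ε) (show 0 < N by omega) x u)
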